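/- Let $\alpha,\beta>-1$. Let $P_n^{\alpha,\beta}$ be the classical Jacobi polynomials and let $\mathcal P_n^{\alpha,\beta}(\theta)=P_n^{\alpha,\beta}(\cos\theta)/\|P_n^{\alpha,\beta}(\cos\cdot)\|_{L^2(d\mu_{\alpha,\beta})}$, where $d\mu_{\alpha,\beta}(\theta)=(\sin\frac\theta2)^{2\alpha+1}(\cos\frac\theta2)^{2\beta+1}\,d\theta$ on $[0,\pi]$. For $t>0$ and $\theta,\varphi\in[0,\pi]$ define the auxiliary kernel $$\mathbb H_t^{\alpha,\beta}(\theta,\varphi)=\sum_{n=0}^\infty e^{-t\left(n+\frac{\alpha+\beta+1}{2}\right)}\mathcal P_n^{\alpha,\beta}(\theta)\,\mathcal P_n^{\alpha,\beta}(\varphi).$$ Put $c_{\alpha,\beta}=\dfrac{\Gamma(\alpha+\beta+2)}{2^{\alpha+\beta+1}\Gamma(\alpha+1)\Gamma(\beta+1)}$, $\;q(\theta,\varphi,u,v)=1-u\sin\frac\theta2\sin\frac\varphi2-v\cos\frac\theta2\cos\frac\varphi2$, and $$\Psi^{\alpha,\beta}(t,\theta,\varphi,u,v)=\frac{c_{\alpha,\beta}\sinh\frac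 t2}{\left(\cosh\frac t2-1+q(\theta,\varphi,u,v)\right)^{\alpha+\beta+2}},\qquad \Psi_E^{\alpha,\beta}(t,\theta,\varphi,u,v)=\frac14\sum_{\xi,\eta=\pm1}\Psi^{\alpha,\beta}(t,\theta,\varphi,\xi u,\eta v).$$ For $\gamma>-1$, $\gamma\neq-\frac12$, let $d\Pi_\gamma(u)=\dfrac{\Gamma(\gamma+1)}{\sqrt\pi\,\Gamma(\gamma+\frac12)}(1-u^2)^{\gamma-\frac12}\,du$ on $(-1,1)$ (for $-1<\gamma<-\frac12$ the density is negative and not integrable), and let $d\Pi_{-1/2}=\frac12(\delta_{-1}+\delta_1)$, where $\delta_{\pm1}$ are unit point masses at $\pm1$. Then for all $\alpha,\beta>-1$, $t>0$ and $\theta,\varphi\in[0,\pi]$ the series defining $\mathbb H_t^{\alpha,\beta}(\theta,\varphi)$ converges absolutely, all integrals below converge absolutely, and, writing $\Psi_E(u,v)$ for $\Psi_E^{\alpha,\beta}(t,\theta,\varphi,u,v)$, $$\begin{aligned}\mathbb H_t^{\alpha,\beta}(\theta,\varphi)={}&4\iint_{(0,1]^2}\Big(\Psi_E(u,v)-\Psi_E(u,1)-\Psi_E(1,v)+\Psi_E(1,1)\Big)\,d\Pi_\alpha(u)\,d\Pi_\beta(v)\\&+2\int_{(0,1]}\Big(\Psi_E(u,1)-\Psi_E(1,1)\Big)\,d\Pi_\alpha(u)+2\int_{(0,1]}\Big(\Psi_E(1,v)-\Psi_E(1,1)\Big)\,d\Pi_\beta(v)+\Psi_E(1,1).\end{aligned}$$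 -/

import Mathlib

open MeasureTheory

noncomputable section

namespace JacobiPoisson

/-- The classical Jacobi polynomial `P_n^{(α,β)}(x)`, expanded in powers of `(x - 1) / 2`:
`∑ k ≤ n, (n choose k) / n! * (n+α+β+1)_k * (α+k+1)_{n-k} * ((x-1)/2)^k`,
where `(a)_k` is the rising Pochhammer symbol. -/
def jacobiP (α β : ℝ) (n : ℕ) (x : ℝ) : ℝ :=
  ∑ k ∈ Finset.range (n + 1),
    ((n.choose k : ℝ) / (n.factorial : ℝ))
      * (ascPochhammer ℝ k).eval ((n : ℝ) + α + β + 1)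
      * (ascPochhammer ℝ (n - k)).eval (α + (k : ℝ) + 1)
      * ((x - 1) / 2) ^ k

/-- The measure `(sin (θ/2))^(2α+1) (cos (θ/2))^(2β+1) dθ` on `[0, π]`. -/
def jacobiMeasure (α β : ℝ) : Measure ℝ :=
  (volume.restrict (Set.Icc 0 Real.pi)).withDensity fun θ =>
    ENNReal.ofReal (Real.sin (θ / 2) ^ (2 * α + 1) * Real.cos (θ / 2) ^ (2 * β + 1))

/-- The Jacobi trigonometric polynomial `θ ↦ P_n^{(α,β)}(cos θ)`, divided by its norm in
`L²` of `jacobiMeasure α β`. -/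
def trigJacobi (α β : ℝ) (n : ℕ) (θ : ℝ) : ℝ :=
  jacobiP α β n (Real.cos θ) /
    Real.sqrt (∫ τ, jacobiP α β n (Real.cos τ) ^ 2 ∂jacobiMeasure α β)

/-- The `n`-th term of the series defining the auxiliary kernel. -/
def auxKernelTerm (α β t θ φ : ℝ) (n : ℕ) : ℝ :=
  Real.exp (-t * ((n : ℝ) + (α + β + 1) / 2)) * trigJacobi α β n θ * trigJacobi α β n φ

/-- The auxiliary kernel `ℍ_t^{α,β}(θ,φ)`. -/
def auxKernel (α β t θ φ : ℝ) : ℝ :=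
  ∑' n : ℕ, auxKernelTerm α β t θ φ n

/-- The constant `c_{α,β}`. -/
def cConst (α β : ℝ) : ℝ :=
  Real.Gamma (α + β + 2) /
    ((2 : ℝ) ^ (α + β + 1) * Real.Gamma (α + 1) * Real.Gamma (β + 1))

/-- `q(θ,φ,u,v) = 1 - u sin(θ/2) sin(φ/2) - v cos(θ/2) cos(φ/2)`. -/
def qFun (θ φ u v : ℝ) : ℝ :=
  1 - u * Real.sin (θ / 2) * Real.sin (φ / 2) - v * Real.cos (θ / 2) * Real.cos (φ / 2)

/-- `Ψ^{α,β}(t,θ,φ,u,v)`. -/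
def Psi (α β t θ φ u v : ℝ) : ℝ :=
  cConst α β * Real.sinh (t / 2) /
    (Real.cosh (t / 2) - 1 + qFun θ φ u v) ^ (α + β + 2)

/-- `Ψ_E^{α,β}(t,θ,φ,u,v)`, the even part of `Ψ^{α,β}` in both `u` and `v`. -/
def PsiE (α β t θ φ u v : ℝ) : ℝ :=
  (1 / 4) * (Psi α β t θ φ u v + Psi α β t θ φ u (-v)
    + Psi α β t θ φ (-u) v + Psi α β t θ φ (-u) (-v))

/-- The density `Γ(γ+1) / (√π Γ(γ+1/2)) (1 - u²)^(γ-1/2)` of `dΠ_γ` on `(-1,1)`, for `γ > -1`,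
`γ ≠ -1/2`. It is positive for `γ > -1/2`, and negative and not integrable
for `-1 < γ < -1/2`. -/
def piDensity (γ u : ℝ) : ℝ :=
  Real.Gamma (γ + 1) / (Real.sqrt Real.pi * Real.Gamma (γ + 1 / 2))
    * (1 - u ^ 2) ^ (γ - 1 / 2)

/-- The sign of `dΠ_γ`. -/
def piSign (γ : ℝ) : ℝ :=
  if γ < -1 / 2 then -1 else 1

/-- The total variation `|dΠ_γ|`, so that `dΠ_γ = piSign γ • |dΠ_γ|`. For `γ = -1/2` it is the
half-sum of the point masses at `-1` and `1`; otherwise it is `|piDensity γ u| du`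
on `(-1,1)`. -/
def piAbs (γ : ℝ) : Measure ℝ :=
  if γ = -1 / 2 then
    ENNReal.ofReal (1 / 2) • (Measure.dirac (-1) + Measure.dirac 1)
  else
    (volume.restrict (Set.Ioo (-1) 1)).withDensity fun u => ENNReal.ofReal |piDensity γ u|

/-- These measures are s-finite, so the product measures below are the usual ones. -/
instance piAbs_sFinite (γ : ℝ) : SFinite (piAbs γ) := by
  unfold piAbs
  split_ifs <;> infer_instance

/-- `f` is absolutely integrable over `(0,1]` against `dΠ_γ`. -/
def PiIntegrable (γ : ℝ) (f : ℝ → ℝ) : Prop :=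
  IntegrableOn f (Set.Ioc 0 1) (piAbs γ)

/-- `∫_{(0,1]} f(u) dΠ_γ(u)`. -/
def piIntegral (γ : ℝ) (f : ℝ → ℝ) : ℝ :=
  piSign γ * ∫ u in Set.Ioc 0 1, f u ∂piAbs γ

/-- `f` is absolutely integrable over `(0,1]²` against `dΠ_α ⊗ dΠ_β`. -/
def PiIntegrable₂ (α β : ℝ) (f : ℝ → ℝ → ℝ) : Prop :=
  IntegrableOn (fun p : ℝ × ℝ => f p.1 p.2) (Set.Ioc 0 1 ×ˢ Set.Ioc 0 1)
    ((piAbs α).prod (piAbs β))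

/-- `∬_{(0,1]²} f(u,v) dΠ_α(u) dΠ_β(v)`. -/
def piIntegral₂ (α β : ℝ) (f : ℝ → ℝ → ℝ) : ℝ :=
  piSign α * piSign β *
    ∫ p in Set.Ioc 0 1 ×ˢ Set.Ioc 0 1, f p.1 p.2 ∂((piAbs α).prod (piAbs β))

end JacobiPoisson

end

noncomputable section

namespace JacobiPoisson

/-! ### Rising factorials and the terminating hypergeometric form of the Jacobi polynomials. -/

open Finset

/-! Put s = α+β+2, p = e^{-t/2}, a = sin(θ/2) sin(φ/2), b = cos(θ/2) cos(φ/2). Since 1 - 2wp + p² =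
2p (cosh(t/2) - w), the Gegenbauer generating function expands `PsiE` as a constant times ∑ p^{2n}
C_{2n}^s, with C_{2n}^s averaged over the arguments ua ± vb (`hasSum_PsiE`).

The right-hand side of the theorem is a linear functional of `PsiE`, called `regIntegral`. It sends
u^{2i} v^{2j} to (1/2)_i (1/2)_j / ((α+1)_i (β+1)_j). For exponents above -1/2 these are the
ordinary moments; subtracting values at 1 keeps the same formula down to -1, where the measures
themselves are not integrable (`two_mul_piIntegral_pow_sub_one`). Hence C_{2n}^s is sent to an
explicit polynomial R_n in a², b² (`gegenReg`).

On the spectral side, a product of two Jacobi polynomials of equal degree is a terminating Appell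
function F₄ of a², b² (`hypF_mul_hypF`). With its normalising weight it equals R_n - R_{n-1}
(`jacobiWeight_mul_appellF_succ`). So the kernel is a multiple of ∑ p^{2n} (R_n - R_{n-1}) = (1 -
p²) ∑ p^{2n} R_n, and 1 - p² = 2p sinh(t/2) matches the constants.

Series and integrals may be exchanged because the differences of C_{2n}^s are at most (1-u)(1-v),
1-u and 1-v times a bound on its second derivative over [-1,1]. That bound is summable against
p^{2n}, and 1-u is integrable for every exponent above -1. -/

/-- The rising factorial `(x)_k`. -/
abbrev poch (x : ℝ) (k : ℕ) : ℝ := (ascPochhammer ℝ k).eval x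

theorem poch_zero (x : ℝ) : poch x 0 = 1 := by simp [poch]

theorem poch_succ (x : ℝ) (k : ℕ) : poch x (k + 1) = poch x k * (x + k) := by
  simp [poch, ascPochhammer_succ_eval]

theorem poch_succ_left (x : ℝ) (k : ℕ) : poch x (k + 1) = x * poch (x + 1) k := by
  simp [poch, ascPochhammer_succ_left, Polynomial.eval_comp]

theorem poch_add (x : ℝ) (k l : ℕ) : poch x (k + l) = poch x k * poch (x + k) l := by
  simp [poch, ← ascPochhammer_mul, Polynomial.eval_comp]

theorem poch_pos {x : ℝ} (hx : 0 < x) (k : ℕ) : 0 < poch x k := ascPochhammer_pos k x hx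

theorem Gamma_add_nat {x : ℝ} (hx : 0 < x) (k : ℕ) :
    Real.Gamma (x + k) = poch x k * Real.Gamma x := by
  induction k with
  | zero => simp [poch_zero]
  | succ k ih =>
    have h : x + (k : ℝ) ≠ 0 := by positivity
    rw [Nat.cast_succ, ← add_assoc, Real.Gamma_add_one h, ih, poch_succ]
    ring

theorem poch_neg_nat (n k : ℕ) :
    poch (-(n : ℝ)) k = (-1) ^ k * (n.choose k : ℝ) * (k.factorial : ℝ) := by
  induction k with
  | zero => simp [poch_zero]
  | succ k ih =>
    have h := congrArg (Nat.cast (R := ℝ)) (Nat.choose_succ_right_eq n k)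
    rw [poch_succ, ih, Nat.factorial_succ, pow_succ]
    push_cast at h ⊢
    rcases le_or_gt k n with hk | hk
    · rw [Nat.cast_sub hk] at h
      linear_combination (-1 : ℝ) ^ k * (k.factorial : ℝ) * h
    · rw [Nat.choose_eq_zero_of_lt hk, Nat.choose_eq_zero_of_lt (by omega)]
      simp

theorem poch_neg_nat_eq_zero {n k : ℕ} (h : n < k) : poch (-(n : ℝ)) k = 0 := by
  rw [poch_neg_nat, Nat.choose_eq_zero_of_lt h]; simp

/-- The Chu–Vandermonde identity. -/
theorem chu_vandermonde (n : ℕ) (b c : ℝ) (hc : 0 < c) :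
    ∑ k ∈ range (n + 1), (-1) ^ k * (n.choose k : ℝ) * poch b k / poch c k
      = poch (c - b) n / poch c n := by
  induction n generalizing b c with
  | zero => simp [poch_zero]
  | succ n ih =>
    have h := Finset.sum_choose_succ_mul (R := ℝ)
      (fun k _ => (-1) ^ k * poch b k / poch c k) n
    have e : ∀ m : ℕ, ∑ k ∈ range (m + 1), (-1) ^ k * (m.choose k : ℝ) * poch b k / poch c k
        = ∑ k ∈ range (m + 1), (m.choose k : ℝ) * ((-1) ^ k * poch b k / poch c k) := by
      intro m; refine sum_congr rfl fun k _ => ?_; ring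
    rw [e, h, ← e, ih b c hc]
    have h2 : ∑ i ∈ range (n + 1), (n.choose i : ℝ) *
        ((-1) ^ (i + 1) * poch b (i + 1) / poch c (i + 1))
        = -(b / c) * (poch (c - b) n / poch (c + 1) n) := by
      have := ih (b + 1) (c + 1) (by positivity)
      rw [show c + 1 - (b + 1) = c - b by ring] at this
      rw [← this, mul_sum]
      refine sum_congr rfl fun k _ => ?_
      have := (poch_pos (show 0 < c + 1 by positivity) k).ne'
      rw [poch_succ_left, poch_succ_left]
      field_simp
      ring
    rw [h2, poch_succ]
    have h3 := poch_succ_left c n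
    have h5 := poch_succ c n
    have h4 := (poch_pos (show 0 < c + 1 by positivity) n).ne'
    have h6 := (poch_pos hc n).ne'
    have h7 : c + (n : ℝ) ≠ 0 := by positivity
    have h8 : poch (c + 1) n = poch c n * (c + n) / c := by
      field_simp; linarith
    rw [h8, h5]
    field_simp
    ring

/-- `w_k = (-n)_k (n+λ)_k`. -/
def jw (n : ℕ) (l : ℝ) (k : ℕ) : ℝ := poch (-(n : ℝ)) k * poch (n + l) k

theorem jw_zero (n : ℕ) (l : ℝ) : jw n l 0 = 1 := by simp [jw, poch_zero]

theorem jw_succ (n : ℕ) (l : ℝ) (k : ℕ) :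
    jw n l (k + 1) = ((k : ℝ) - n) * (k + n + l) * jw n l k := by
  simp only [jw, poch_succ]; ring

theorem jw_eq_zero {n k : ℕ} (h : n < k) (l : ℝ) : jw n l k = 0 := by
  simp [jw, poch_neg_nat_eq_zero h]

/-- The terminating hypergeometric polynomial `₂F₁(-n, n+λ; c; x)`. -/
def hypF (n : ℕ) (l c x : ℝ) : ℝ :=
  ∑ k ∈ range (n + 1), jw n l k / ((k.factorial : ℝ) * poch c k) * x ^ k

theorem hypF_zero (n : ℕ) (l c : ℝ) : hypF n l c 0 = 1 := by
  simp [hypF, sum_range_succ', jw_zero, poch_zero]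

theorem sum_jw_eq (n : ℕ) (l c : ℝ) (hc : 0 < c) :
    ∑ k ∈ range (n + 1), jw n l k / ((k.factorial : ℝ) * poch c k)
      = poch (c - (n + l)) n / poch c n := by
  rw [← chu_vandermonde n _ c hc]
  refine sum_congr rfl fun k _ => ?_
  have := (poch_pos hc k).ne'
  rw [jw, poch_neg_nat]
  field_simp

theorem poch_reflect (x : ℝ) (n : ℕ) : poch (-(n : ℝ) - x + 1) n = (-1) ^ n * poch x n := by
  induction n generalizing x with
  | zero => simp [poch_zero]
  | succ n ih =>
    rw [poch_succ, poch_succ_left x]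
    have := ih (x + 1)
    rw [show -((n + 1 : ℕ) : ℝ) - x + 1 = -(n : ℝ) - (x + 1) + 1 by push_cast; ring, this]
    ring

/-- Chu–Vandermonde gives (c-n-l)_n / (c)_n, and c + d = l + 1 turns the numerator into (-n-d+1)_n,
whose factors are those of (d)_n reversed and negated. -/
theorem hypF_one (n : ℕ) (l c d : ℝ) (hc : 0 < c) (h : c + d = l + 1) :
    hypF n l c 1 = (-1) ^ n * poch d n / poch c n := by
  simp only [hypF, one_pow, mul_one]
  rw [sum_jw_eq n l c hc, ← poch_reflect]
  congr 3; linarith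

theorem jacobiP_cos (α β : ℝ) (hα : -1 < α) (n : ℕ) (θ : ℝ) :
    jacobiP α β n (Real.cos θ) = poch (α + 1) n / (n.factorial : ℝ) *
      hypF n (α + β + 1) (α + 1) (Real.sin (θ / 2) ^ 2) := by
  have h1 : (Real.cos θ - 1) / 2 = -Real.sin (θ / 2) ^ 2 := by
    have := Real.cos_sq (θ / 2)
    have h2 := Real.sin_sq_add_cos_sq (θ / 2)
    rw [show 2 * (θ / 2) = θ by ring] at this
    linarith
  rw [jacobiP, hypF, mul_sum]
  refine sum_congr rfl fun k hk => ?_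
  have hk : k ≤ n := by simpa [Nat.lt_succ_iff] using hk
  have h2 : poch (α + 1) n = poch (α + 1) k * poch (α + k + 1) (n - k) := by
    conv_lhs => rw [← Nat.add_sub_cancel' hk, poch_add]
    rw [show α + 1 + (k : ℝ) = α + k + 1 by ring]
  have h3 := (poch_pos (show 0 < α + 1 by linarith) k).ne'
  rw [h1, h2, neg_pow, jw, poch_neg_nat, show (n : ℝ) + α + β + 1 = n + (α + β + 1) by ring]
  field_simp

/-! ### Product formula for Jacobi polynomials through the Jacobi differential equation. -/

section ProductFormula

open Polynomial

/-- Coefficients `1 / (k! (c)_k)`. -/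
def jcoef (c : ℝ) (k : ℕ) : ℝ := 1 / ((k.factorial : ℝ) * poch c k)

theorem jcoef_zero (c : ℝ) : jcoef c 0 = 1 := by simp [jcoef, poch_zero]

theorem jcoef_succ {c : ℝ} (hc : 0 < c) (k : ℕ) :
    jcoef c (k + 1) * ((k + 1) * (c + k)) = jcoef c k := by
  have h1 := (poch_pos hc k).ne'
  have h2 : c + (k : ℝ) ≠ 0 := by positivity
  rw [jcoef, jcoef, poch_succ, Nat.factorial_succ]
  push_cast
  field_simp

/-- `S_n(p, q) = ∑_{i+j ≤ n} (-n)_{i+j} (n+λ)_{i+j} p^i q^j / (i! j! (c)_i (d)_j)`, the terminating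
Appell function `F₄(-n, n+λ; c, d; p, q)`. -/
def appellF (n : ℕ) (l c d p q : ℝ) : ℝ :=
  ∑ m ∈ range (n + 1), jw n l m *
    ∑ ij ∈ antidiagonal m, jcoef c ij.1 * p ^ ij.1 * (jcoef d ij.2 * q ^ ij.2)

/-- `(yX)^k / (k! (c)_k)` as a polynomial. -/
def polyA (c y : ℝ) (k : ℕ) : ℝ[X] := C (jcoef c k * y ^ k) * X ^ k

/-- `((1-y)(1-X))^k / (k! (d)_k)` as a polynomial. -/
def polyB (d y : ℝ) (k : ℕ) : ℝ[X] := C (jcoef d k * (1 - y) ^ k) * (1 - X) ^ k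

theorem X_mul_derivative_polyA (c y : ℝ) (k : ℕ) :
    X * derivative (polyA c y k) = C (k : ℝ) * polyA c y k := by
  cases k with
  | zero => simp [polyA]
  | succ k =>
    simp only [polyA, derivative_mul, derivative_C, derivative_X_pow]
    simp
    ring

/-- The coefficients `jcoef` are chosen so that X∂² + c∂ lowers the index by one; `polyB_ode` is its
mirror image under X ↦ 1-X. -/
theorem polyA_ode {c : ℝ} (hc : 0 < c) (y : ℝ) (k : ℕ) :
    X * derivative (derivative (polyA c y (k + 1))) + C c * derivative (polyA c y (k + 1))
      = C y * polyA c y k := by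
  have h1 : derivative (polyA c y (k + 1))
      = C (jcoef c (k + 1) * y ^ (k + 1) * (k + 1)) * X ^ k := by
    simp only [polyA, derivative_mul, derivative_C, derivative_X_pow]
    simp
    ring
  have h2 : X * derivative (derivative (polyA c y (k + 1)))
      = C (jcoef c (k + 1) * y ^ (k + 1) * (k + 1) * k) * X ^ k := by
    rw [h1]
    cases k with
    | zero => simp
    | succ k =>
      simp only [derivative_mul, derivative_C, derivative_X_pow]
      simp
      ring
  rw [h2, h1, polyA, ← jcoef_succ hc k]
  simp only [C_mul, C_add, C_pow]
  ring

theorem X_mul_polyA {c : ℝ} (hc : 0 < c) (y : ℝ) (k : ℕ) :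
    X * (C y * polyA c y k) = C (((k : ℝ) + 1) * (c + k)) * polyA c y (k + 1) := by
  rw [polyA, polyA, ← jcoef_succ hc k]
  simp only [C_mul, C_add, C_pow]
  ring

theorem X_mul_derivative_polyB (d y : ℝ) (k : ℕ) :
    (1 - X) * derivative (polyB d y k) = - (C (k : ℝ) * polyB d y k) := by
  cases k with
  | zero => simp [polyB]
  | succ k =>
    simp only [polyB, derivative_mul, derivative_C, derivative_pow, derivative_sub, derivative_one,
      derivative_X]
    simp
    ring

theorem polyB_ode {d : ℝ} (hd : 0 < d) (y : ℝ) (k : ℕ) :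
    (1 - X) * derivative (derivative (polyB d y (k + 1))) - C d * derivative (polyB d y (k + 1))
      = C (1 - y) * polyB d y k := by
  have h1 : derivative (polyB d y (k + 1))
      = - (C (jcoef d (k + 1) * (1 - y) ^ (k + 1) * (k + 1)) * (1 - X) ^ k) := by
    simp only [polyB, derivative_mul, derivative_C, derivative_pow, derivative_sub, derivative_one,
      derivative_X]
    simp
    ring
  have h2 : (1 - X) * derivative (derivative (polyB d y (k + 1)))
      = C (jcoef d (k + 1) * (1 - y) ^ (k + 1) * (k + 1) * k) * (1 - X) ^ k := by
    rw [h1]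
    cases k with
    | zero => simp
    | succ k =>
      simp only [derivative_mul, derivative_C, derivative_pow, derivative_sub, derivative_one,
        derivative_X, derivative_neg]
      simp
      ring
  rw [h2, h1, polyB, ← jcoef_succ hd k]
  simp only [C_mul, C_add, C_pow]
  ring

theorem X_mul_polyB {d : ℝ} (hd : 0 < d) (y : ℝ) (k : ℕ) :
    (1 - X) * (C (1 - y) * polyB d y k)
      = C (((k : ℝ) + 1) * (d + k)) * polyB d y (k + 1) := by
  rw [polyB, polyB, ← jcoef_succ hd k]
  simp only [C_mul, C_add, C_pow]
  ring

/-- Shift of a sequence: `0, f 0, f 1, …`. -/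
def shiftSeq (f : ℕ → ℝ[X]) : ℕ → ℝ[X]
  | 0 => 0
  | k + 1 => f k

theorem polyA_ode' {c : ℝ} (hc : 0 < c) (y : ℝ) (k : ℕ) :
    X * derivative (derivative (polyA c y k)) + C c * derivative (polyA c y k)
      = C y * shiftSeq (polyA c y) k := by
  cases k with
  | zero => simp [polyA, shiftSeq]
  | succ k => exact polyA_ode hc y k

theorem X_mul_polyA' {c : ℝ} (hc : 0 < c) (y : ℝ) (k : ℕ) :
    X * (C y * shiftSeq (polyA c y) k) = C ((k : ℝ) * (c + k - 1)) * polyA c y k := by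
  cases k with
  | zero => simp [shiftSeq]
  | succ k =>
    rw [shiftSeq, X_mul_polyA hc]
    congr 2; push_cast; ring

theorem polyB_ode' {d : ℝ} (hd : 0 < d) (y : ℝ) (k : ℕ) :
    (1 - X) * derivative (derivative (polyB d y k)) - C d * derivative (polyB d y k)
      = C (1 - y) * shiftSeq (polyB d y) k := by
  cases k with
  | zero => simp [polyB, shiftSeq]
  | succ k => exact polyB_ode hd y k

theorem X_mul_polyB' {d : ℝ} (hd : 0 < d) (y : ℝ) (k : ℕ) :
    (1 - X) * (C (1 - y) * shiftSeq (polyB d y) k)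
      = C ((k : ℝ) * (d + k - 1)) * polyB d y k := by
  cases k with
  | zero => simp [shiftSeq]
  | succ k =>
    rw [shiftSeq, X_mul_polyB hd]
    congr 2; push_cast; ring

/-- The Jacobi operator `X(1-X) f'' + (c - (c+d)X) f'`. -/
def jacobiOp (c d : ℝ) : ℝ[X] →ₗ[ℝ] ℝ[X] where
  toFun f := X * (1 - X) * derivative (derivative f) + (C c - C (c + d) * X) * derivative f
  map_add' f g := by simp only [derivative_add]; ring
  map_smul' r f := by simp only [RingHom.id_apply, smul_eq_C_mul, derivative_C_mul]; ring

theorem jacobiOp_apply (c d : ℝ) (f : ℝ[X]) : jacobiOp c d f =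
    X * (1 - X) * derivative (derivative f) + (C c - C (c + d) * X) * derivative f := rfl

/-- By Leibniz the operator splits into (1-X)(X∂² + c∂) on the first factor, X((1-X)∂² - d∂) on the
second, and cross terms. The Euler identities X∂A = iA and (1-X)∂B = -jB turn the cross terms into
scalars, and all scalars add up to a function of i+j alone. -/
theorem jacobiOp_polyA_mul_polyB {c d : ℝ} (hc : 0 < c) (hd : 0 < d) (y : ℝ) (i j : ℕ) :
    jacobiOp c d (polyA c y i * polyB d y j) =
      C y * (shiftSeq (polyA c y) i * polyB d y j)
        + C (1 - y) * (polyA c y i * shiftSeq (polyB d y) j)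
        - C (((i + j : ℕ) : ℝ) * ((i + j : ℕ) + (c + d - 1))) * (polyA c y i * polyB d y j) := by
  have a1 := X_mul_derivative_polyA c y i
  have a2 := polyA_ode' hc y i
  have a3 := X_mul_polyA' hc y i
  have b1 := X_mul_derivative_polyB d y j
  have b2 := polyB_ode' hd y j
  have b3 := X_mul_polyB' hd y j
  rw [jacobiOp_apply]
  set A := polyA c y i
  set B := polyB d y j
  set A' := shiftSeq (polyA c y) i
  set B' := shiftSeq (polyB d y) j
  simp only [derivative_mul, derivative_add, C_add, C_mul, C_sub, C_1, Nat.cast_add] at *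
  linear_combination (1 - X) * B * a2 - B * a3 + X * A * b2 - A * b3
    + (2 * (1 - X) * derivative B - C d * B) * a1 + (C c * A + 2 * C (i : ℝ) * A) * b1

/-- The homogeneous part of degree `m` of the Appell function. -/
def polyH (c d y : ℝ) (m : ℕ) : ℝ[X] :=
  ∑ ij ∈ antidiagonal m, polyA c y ij.1 * polyB d y ij.2

/-- The two index shifts both produce the homogeneous part of degree m-1, with weights y and 1-y
that sum to 1. -/
theorem jacobiOp_polyH {c d : ℝ} (hc : 0 < c) (hd : 0 < d) (y : ℝ) (m : ℕ) :
    jacobiOp c d (polyH c d y m) = shiftSeq (polyH c d y) m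
      - C ((m : ℝ) * (m + (c + d - 1))) * polyH c d y m := by
  have h0 : jacobiOp c d (polyH c d y m) =
      C y * (∑ ij ∈ antidiagonal m, shiftSeq (polyA c y) ij.1 * polyB d y ij.2)
      + C (1 - y) * (∑ ij ∈ antidiagonal m, polyA c y ij.1 * shiftSeq (polyB d y) ij.2)
      - C ((m : ℝ) * (m + (c + d - 1))) * polyH c d y m := by
    rw [polyH, map_sum, mul_sum, mul_sum, mul_sum, ← sum_add_distrib, ← sum_sub_distrib]
    refine sum_congr rfl fun ij hij => ?_
    rw [jacobiOp_polyA_mul_polyB hc hd, mem_antidiagonal.1 hij]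
  rw [h0]
  cases m with
  | zero => simp [shiftSeq]
  | succ m =>
    rw [Finset.Nat.sum_antidiagonal_succ, Finset.Nat.sum_antidiagonal_succ']
    simp only [shiftSeq, zero_mul, mul_zero, zero_add, polyH, C_sub, C_1]
    ring

/-- `S_n(yX, (1-y)(1-X))` as a polynomial in `X`. -/
def polyS (n : ℕ) (l c d y : ℝ) : ℝ[X] := ∑ m ∈ range (n + 1), C (jw n l m) * polyH c d y m

theorem eval_polyS (n : ℕ) (l c d x y : ℝ) :
    (polyS n l c d y).eval x = appellF n l c d (x * y) ((1 - x) * (1 - y)) := by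
  simp only [polyS, appellF, eval_finsetSum, eval_mul, eval_C, polyH, polyA, polyB, eval_pow,
    eval_X, eval_sub, eval_one, mul_pow]
  refine sum_congr rfl fun m _ => ?_
  congr 1
  refine sum_congr rfl fun m _ => ?_
  ring

/-- The recursion `jw_succ` makes the sum over m telescope, and the boundary term vanishes because
`jw n l (n + 1)` contains the factor zero of (-n)_{n+1}. -/
theorem jacobiOp_polyS (n : ℕ) {l c d : ℝ} (hc : 0 < c) (hd : 0 < d) (h : c + d = l + 1) (y : ℝ) :
    jacobiOp c d (polyS n l c d y) = - (C ((n : ℝ) * (n + l)) * polyS n l c d y) := by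
  have key : ∀ N : ℕ, ∑ m ∈ range N, (C (jw n l m) * (jacobiOp c d (polyH c d y m)
      + C ((n : ℝ) * (n + l)) * polyH c d y m))
      = - (C (jw n l N) * shiftSeq (polyH c d y) N) := by
    intro N
    induction N with
    | zero => simp [shiftSeq]
    | succ N ih =>
      rw [sum_range_succ, ih, jacobiOp_polyH hc hd, jw_succ,
        show c + d - 1 = l by linarith]
      simp only [shiftSeq, C_mul, C_add, C_sub]
      ring
  have := key (n + 1)
  rw [jw_eq_zero (Nat.lt_succ_self n)] at this
  rw [eq_neg_iff_add_eq_zero, polyS, map_sum, mul_sum, ← sum_add_distrib]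
  simp only [C_0, zero_mul, neg_zero] at this
  rw [← this]
  refine sum_congr rfl fun m _ => ?_
  rw [← smul_eq_C_mul (jw n l m), map_smul, smul_eq_C_mul, smul_eq_C_mul]
  ring

/-- Uniqueness at the regular singular point 0: for c > 0 the factor (k+1)(c+k) never vanishes, so
the recursion determines a polynomial solution from its constant term. -/
theorem coeff_of_jacobiOp_eq {n : ℕ} {l c d : ℝ} (hc : 0 < c) (h : c + d = l + 1) {f : ℝ[X]}
    (hf : jacobiOp c d f = - (C ((n : ℝ) * (n + l)) * f)) (k : ℕ) :
    f.coeff k = f.coeff 0 * (jw n l k * jcoef c k) := by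
  induction k with
  | zero => simp [jw_zero, jcoef_zero]
  | succ k ih =>
    have h1 : f.coeff (k + 1) * ((k + 1) * (c + k)) = ((k : ℝ) - n) * (k + n + l) * f.coeff k := by
      have := congrArg (fun p => Polynomial.coeff p k) hf
      rw [jacobiOp_apply, h] at this
      rw [show X * (1 - X) * derivative (derivative f) + (C c - C (l + 1) * X) * derivative f
        = X * derivative (derivative f) - X * (X * derivative (derivative f))
          + C c * derivative f - C (l + 1) * (X * derivative f) by ring] at this
      rcases k with _ | _ | k
      · simp only [coeff_add, coeff_sub, coeff_neg, coeff_C_mul, coeff_X_mul_zero,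
          coeff_derivative] at this
        push_cast at this ⊢
        linarith
      · simp only [coeff_add, coeff_sub, coeff_neg, coeff_C_mul, coeff_X_mul, coeff_X_mul_zero,
          coeff_derivative] at this
        push_cast at this ⊢
        linarith
      · simp only [coeff_add, coeff_sub, coeff_neg, coeff_C_mul, coeff_X_mul,
          coeff_derivative] at this
        push_cast at this ⊢
        linarith
    have h2 : ((k : ℝ) + 1) * (c + k) ≠ 0 := by positivity
    rw [ih] at h1
    rw [← mul_left_inj' h2, h1, jw_succ, ← jcoef_succ hc k]
    ring

/-- As a polynomial in x the Appell function solves the Jacobi equation, hence is a multiple of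
`hypF n l c x`; the multiple is its value at x = 0, where only the terms with i = 0 survive. -/
theorem appellF_eq_mul (n : ℕ) {l c d : ℝ} (hc : 0 < c) (hd : 0 < d) (h : c + d = l + 1)
    (x y : ℝ) : appellF n l c d (x * y) ((1 - x) * (1 - y))
      = hypF n l d (1 - y) * hypF n l c x := by
  have h0 := coeff_of_jacobiOp_eq hc h (jacobiOp_polyS n hc hd h y)
  have h1 : polyS n l c d y = C ((polyS n l c d y).coeff 0) *
      ∑ k ∈ range (n + 1), C (jw n l k * jcoef c k) * X ^ k := by
    ext k
    rw [h0 k, coeff_C_mul, finsetSum_coeff]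
    simp only [coeff_C_mul, coeff_X_pow]
    simp only [mul_ite, mul_one, mul_zero]
    rw [sum_ite_eq]
    split_ifs with hk
    · rfl
    · rw [jw_eq_zero (by simpa using hk)]; simp
  have h2 : (polyS n l c d y).coeff 0 = hypF n l d (1 - y) := by
    rw [coeff_zero_eq_eval_zero, eval_polyS, appellF, hypF]
    refine sum_congr rfl fun m _ => ?_
    rw [sum_eq_single (0, m)]
    · simp [jcoef_zero]; simp [jcoef]; ring
    · rintro ⟨i, j⟩ hij hne
      have : i ≠ 0 := by
        rintro rfl
        simp at hij; simp [hij] at hne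
      simp [this]
    · simp
  rw [← eval_polyS, h1, h2]
  simp only [eval_mul, eval_C, eval_finsetSum, eval_pow, eval_X, hypF]
  congr 1
  refine sum_congr rfl fun k _ => ?_
  rw [jcoef]; ring

/-- The Appell function is symmetric in x and y, so the factorisations at (0, y) and (y, 0) can be
compared. -/
theorem hypF_one_sub (n : ℕ) {l c d : ℝ} (hc : 0 < c) (hd : 0 < d) (h : c + d = l + 1) (y : ℝ) :
    hypF n l d (1 - y) = hypF n l d 1 * hypF n l c y := by
  have h1 := appellF_eq_mul n hc hd h 0 y
  have h2 := appellF_eq_mul n hc hd h y 0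
  rw [hypF_zero] at h1
  rw [sub_zero] at h2
  rw [← h2, ← mul_one (hypF n l d (1 - y)), ← h1]
  ring_nf

/-- The product formula: Jacobi polynomials multiply to a terminating Appell function. -/
theorem hypF_mul_hypF (n : ℕ) {l c d : ℝ} (hc : 0 < c) (hd : 0 < d) (h : c + d = l + 1)
    (x y : ℝ) : (-1) ^ n * poch c n / poch d n * (hypF n l c x * hypF n l c y)
      = appellF n l c d (x * y) ((1 - x) * (1 - y)) := by
  rw [appellF_eq_mul n hc hd h, hypF_one_sub n hc hd h, hypF_one n l d c hd (by linarith)]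
  ring

end ProductFormula

/-! ### Beta integrals and the L² norms of the Jacobi polynomials. -/

theorem ofReal_betaIntegrand {a b x : ℝ} (hx : x ∈ Set.Ioo (0 : ℝ) 1) :
    (x : ℂ) ^ ((a : ℂ) - 1) * (1 - (x : ℂ)) ^ ((b : ℂ) - 1)
      = ((x ^ (a - 1) * (1 - x) ^ (b - 1) : ℝ) : ℂ) := by
  rw [Complex.ofReal_mul, Complex.ofReal_cpow hx.1.le, Complex.ofReal_cpow (by linarith [hx.2])]
  push_cast
  rfl

theorem integrableOn_betaIntegrand {a b : ℝ} (ha : 0 < a) (hb : 0 < b) :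
    IntegrableOn (fun x : ℝ => x ^ (a - 1) * (1 - x) ^ (b - 1)) (Set.Ioo 0 1) := by
  have h := Complex.betaIntegral_convergent (u := a) (v := b) (by simpa) (by simpa)
  rw [intervalIntegrable_iff_integrableOn_Ioo_of_le zero_le_one] at h
  refine IntegrableOn.congr_fun h.re ?_ measurableSet_Ioo
  intro x hx
  simp only
  rw [ofReal_betaIntegrand hx]
  simp

theorem integral_betaIntegrand {a b : ℝ} (ha : 0 < a) (hb : 0 < b) :
    ∫ x in Set.Ioo (0 : ℝ) 1, x ^ (a - 1) * (1 - x) ^ (b - 1)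
      = Real.Gamma a * Real.Gamma b / Real.Gamma (a + b) := by
  have h := Complex.betaIntegral_eq_Gamma_mul_div (a : ℂ) b (by simpa) (by simpa)
  rw [Complex.betaIntegral, intervalIntegral.integral_of_le zero_le_one,
    integral_Ioc_eq_integral_Ioo,
    setIntegral_congr_fun measurableSet_Ioo fun x hx => ofReal_betaIntegrand hx,
    integral_complex_ofReal, ← Complex.ofReal_add, Complex.Gamma_ofReal, Complex.Gamma_ofReal,
    Complex.Gamma_ofReal] at h
  exact_mod_cast h

/-- Integration against `jacobiMeasure` in the variable `y = sin² (θ/2)`. -/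
theorem integral_jacobiMeasure (α β : ℝ) (f : ℝ → ℝ) :
    ∫ θ, f (Real.sin (θ / 2) ^ 2) ∂jacobiMeasure α β
      = ∫ y in Set.Ioo (0 : ℝ) 1, y ^ α * (1 - y) ^ β * f y := by
  have hmeas : Measurable fun θ : ℝ =>
      ENNReal.ofReal (Real.sin (θ / 2) ^ (2 * α + 1) * Real.cos (θ / 2) ^ (2 * β + 1)) := by
    fun_prop
  have hpos : ∀ θ ∈ Set.Ioo 0 Real.pi, 0 < Real.sin (θ / 2) ∧ 0 < Real.cos (θ / 2) := by
    intro θ hθ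
    exact ⟨Real.sin_pos_of_pos_of_lt_pi (by linarith [hθ.1]) (by linarith [hθ.2, Real.pi_pos]),
      Real.cos_pos_of_mem_Ioo ⟨by linarith [hθ.1, Real.pi_pos], by linarith [hθ.2]⟩⟩
  have himg : (fun θ : ℝ => Real.sin (θ / 2) ^ 2) '' Set.Ioo 0 Real.pi = Set.Ioo 0 1 := by
    ext y
    constructor
    · rintro ⟨θ, hθ, rfl⟩
      have := hpos θ hθ
      have h2 := Real.sin_sq_add_cos_sq (θ / 2)
      constructor
      · have := this.1; positivity
      · have := pow_pos this.2 2; simp only; linarith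
    · rintro ⟨h0, h1⟩
      have hs0 : 0 < Real.sqrt y := Real.sqrt_pos.2 h0
      have hs1 : Real.sqrt y < 1 := by rw [Real.sqrt_lt' one_pos]; simpa
      refine ⟨2 * Real.arcsin (Real.sqrt y), ⟨?_, ?_⟩, ?_⟩
      · have := Real.arcsin_pos.2 hs0; linarith
      · have := Real.arcsin_lt_pi_div_two.2 hs1; linarith
      · simp only
        rw [mul_div_cancel_left₀ _ two_ne_zero, Real.sin_arcsin (by linarith) hs1.le,
          Real.sq_sqrt h0.le]
  have hderiv : ∀ θ ∈ Set.Ioo 0 Real.pi, HasDerivWithinAt (fun θ : ℝ => Real.sin (θ / 2) ^ 2)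
      (Real.sin (θ / 2) * Real.cos (θ / 2)) (Set.Ioo 0 Real.pi) θ := by
    intro θ _
    have h := (((hasDerivAt_id θ).div_const 2).sin.pow 2).hasDerivWithinAt
      (s := Set.Ioo 0 Real.pi)
    refine h.congr_deriv ?_
    simp
    ring
  have hinj : Set.InjOn (fun θ : ℝ => Real.sin (θ / 2) ^ 2) (Set.Ioo 0 Real.pi) := by
    intro x hx y hy hxy
    have h1 := (pow_left_inj₀ (hpos x hx).1.le (hpos y hy).1.le two_ne_zero).1 hxy
    have := Real.injOn_sin ⟨by linarith [hx.1, Real.pi_pos], by linarith [hx.2]⟩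
      ⟨by linarith [hy.1, Real.pi_pos], by linarith [hy.2]⟩ h1
    linarith
  rw [← himg, integral_image_eq_integral_abs_deriv_smul measurableSet_Ioo hderiv hinj,
    jacobiMeasure, integral_withDensity_eq_integral_toReal_smul hmeas
      (Filter.Eventually.of_forall fun _ => ENNReal.ofReal_lt_top),
    integral_Icc_eq_integral_Ioo]
  refine setIntegral_congr_fun measurableSet_Ioo fun θ hθ => ?_
  obtain ⟨hs, hc⟩ := hpos θ hθ
  have h2 : 1 - Real.sin (θ / 2) ^ 2 = Real.cos (θ / 2) ^ 2 := by
    linarith [Real.sin_sq_add_cos_sq (θ / 2)]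
  rw [h2, ENNReal.toReal_ofReal (by positivity), abs_of_pos (by positivity), Real.rpow_add hs,
    Real.rpow_add hc, Real.rpow_one, Real.rpow_one, Real.rpow_mul hs.le, Real.rpow_mul hc.le]
  norm_num
  ring

/-- Termwise Beta integrals cancel the (c)_k and leave a Chu–Vandermonde sum with parameter c+d+m.
For m < n the factor (1+m-n)_n is zero, which is the orthogonality to lower degrees. -/
theorem integral_hypF_mul_one_sub_pow {c d l : ℝ} (hc : 0 < c) (hd : 0 < d) (h : c + d = l + 1)
    (n m : ℕ) :
    IntegrableOn (fun y => y ^ (c - 1) * (1 - y) ^ (d - 1) * (hypF n l c y * (1 - y) ^ m))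
      (Set.Ioo (0 : ℝ) 1) ∧
    ∫ y in Set.Ioo (0 : ℝ) 1, y ^ (c - 1) * (1 - y) ^ (d - 1) * (hypF n l c y * (1 - y) ^ m)
      = Real.Gamma c * Real.Gamma (d + m) / Real.Gamma (c + d + m)
        * (poch (1 + m - n) n / poch (c + d + m) n) := by
  have hcd : 0 < c + d + m := by positivity
  have e : Set.EqOn
      (fun y : ℝ => y ^ (c - 1) * (1 - y) ^ (d - 1) * (hypF n l c y * (1 - y) ^ m))
      (fun y => ∑ k ∈ range (n + 1), jw n l k / ((k.factorial : ℝ) * poch c k) *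
        (y ^ (c + k - 1) * (1 - y) ^ (d + m - 1))) (Set.Ioo 0 1) := by
    intro y hy
    have hy1 : 0 < 1 - y := by linarith [hy.2]
    simp only
    rw [hypF, sum_mul, mul_sum]
    refine sum_congr rfl fun k _ => ?_
    rw [show c + k - 1 = c - 1 + k by ring, show d + m - 1 = d - 1 + m by ring,
      Real.rpow_add hy.1, Real.rpow_add hy1, Real.rpow_natCast, Real.rpow_natCast]
    ring
  have hi : ∀ k ∈ range (n + 1), IntegrableOn (fun y : ℝ =>
      jw n l k / ((k.factorial : ℝ) * poch c k) *
        (y ^ (c + k - 1) * (1 - y) ^ (d + m - 1))) (Set.Ioo 0 1) := fun k _ =>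
    (integrableOn_betaIntegrand (by positivity) (by positivity)).const_mul _
  refine ⟨IntegrableOn.congr_fun (integrable_finsetSum _ hi) e.symm measurableSet_Ioo, ?_⟩
  rw [setIntegral_congr_fun measurableSet_Ioo e, integral_finsetSum _ hi]
  have h1 := sum_jw_eq n l (c + d + m) hcd
  rw [show c + d + m - (n + l) = 1 + m - n by linarith] at h1
  rw [← h1, mul_sum]
  refine sum_congr rfl fun k _ => ?_
  have p1 := (poch_pos hc k).ne'
  have p2 := (poch_pos hcd k).ne'
  have p3 := (Real.Gamma_pos_of_pos hcd).ne'
  rw [integral_const_mul, integral_betaIntegrand (by positivity) (by positivity),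
    Gamma_add_nat hc, show c + k + (d + m) = c + d + m + k by ring, Gamma_add_nat hcd]
  field_simp

theorem poch_add_self_pos {l : ℝ} (hl : -1 < l) (n : ℕ) : 0 < poch (n + l) n := by
  -- The number l may be negative, so n = 0 rests on the empty product; from n = 1 on the base n + l
  -- is positive.
  cases n with
  | zero => simp [poch_zero]
  | succ n => exact poch_pos (by push_cast; linarith [n.cast_nonneg (α := ℝ)]) _

/-- One of the two factors is expanded in powers of 1-y by `hypF_one_sub`; orthogonality leaves only
the top power m = n. -/
theorem integral_hypF_sq {c d l : ℝ} (hc : 0 < c) (hd : 0 < d) (h : c + d = l + 1) (n : ℕ) :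
    ∫ y in Set.Ioo (0 : ℝ) 1, y ^ (c - 1) * (1 - y) ^ (d - 1) * hypF n l c y ^ 2
      = (n.factorial : ℝ) * poch (n + l) n * poch d n * Real.Gamma c * Real.Gamma d /
        (poch c n * poch (l + 1) (2 * n) * Real.Gamma (l + 1)) := by
  have hl : 0 < l + 1 := by linarith
  have p1 := (poch_pos hc n).ne'
  have p2 := (poch_pos hd n).ne'
  have p3 : hypF n l d 1 ≠ 0 := by
    rw [hypF_one n l d c hd (by linarith)]
    exact div_ne_zero (mul_ne_zero (pow_ne_zero _ (by norm_num)) p1) p2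
  have e : ∀ y : ℝ, y ^ (c - 1) * (1 - y) ^ (d - 1) * hypF n l c y ^ 2 =
      ∑ m ∈ range (n + 1), (jw n l m / ((m.factorial : ℝ) * poch d m) / hypF n l d 1) *
        (y ^ (c - 1) * (1 - y) ^ (d - 1) * (hypF n l c y * (1 - y) ^ m)) := by
    intro y
    have h1 := hypF_one_sub n hc hd h y
    have h2 : hypF n l c y ^ 2 = hypF n l (d) (1 - y) / hypF n l d 1 * hypF n l c y := by
      rw [h1]; field_simp
    rw [h2, hypF, sum_div, sum_mul, mul_sum]
    refine sum_congr rfl fun k _ => ?_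
    ring
  have hi := fun m => integral_hypF_mul_one_sub_pow hc hd h n m
  rw [integral_congr_ae (Filter.Eventually.of_forall e),
    integral_finsetSum _ fun m _ => (hi m).1.const_mul _, sum_range_succ, sum_eq_zero, zero_add]
  · have p4 := (poch_pos (show 0 < l + 1 + n by positivity) n).ne'
    have p5 := (poch_pos hl n).ne'
    have p6 := (Real.Gamma_pos_of_pos hl).ne'
    have p7 : poch 1 n = n.factorial := by
      simp
    rw [integral_const_mul, (hi n).2, hypF_one n l d c hd (by linarith), h, Gamma_add_nat hl,
      Gamma_add_nat hd, two_mul, poch_add (l + 1), jw, poch_neg_nat, Nat.choose_self,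
      add_sub_cancel_right, p7]
    field_simp
    simp
  · intro m hm
    have hm : m < n := by simpa using hm
    rw [integral_const_mul, (hi m).2]
    obtain ⟨k, rfl⟩ := Nat.exists_eq_add_of_lt hm
    rw [show (1 + (m : ℝ) - (m + k + 1 : ℕ)) = -(k : ℝ) by push_cast; ring,
      poch_neg_nat_eq_zero (by omega)]
    simp

theorem integral_jacobiP_sq {α β : ℝ} (hα : -1 < α) (hβ : -1 < β) (n : ℕ) :
    ∫ τ, jacobiP α β n (Real.cos τ) ^ 2 ∂jacobiMeasure α β
      = (poch (α + 1) n / (n.factorial : ℝ)) ^ 2 *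
        ((n.factorial : ℝ) * poch (n + (α + β + 1)) n * poch (β + 1) n * Real.Gamma (α + 1)
          * Real.Gamma (β + 1) /
        (poch (α + 1) n * poch (α + β + 2) (2 * n) * Real.Gamma (α + β + 2))) := by
  have h := integral_hypF_sq (c := α + 1) (d := β + 1) (l := α + β + 1) (by linarith)
    (by linarith) (by ring) n
  simp only [add_sub_cancel_right] at h
  rw [show α + β + 1 + 1 = α + β + 2 by ring] at h
  rw [← h, ← integral_jacobiMeasure, ← integral_const_mul]
  refine integral_congr_ae (Filter.Eventually.of_forall fun τ => ?_)
  simp only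
  rw [jacobiP_cos α β hα, mul_pow]

/-- Products of normalised Jacobi polynomials as terminating Appell functions. -/
theorem trigJacobi_mul {α β : ℝ} (hα : -1 < α) (hβ : -1 < β) (n : ℕ) (θ φ : ℝ) :
    trigJacobi α β n θ * trigJacobi α β n φ =
      (-1) ^ n * poch (α + β + 2) (2 * n) /
        ((n.factorial : ℝ) * poch (n + (α + β + 1)) n) *
      (Real.Gamma (α + β + 2) / (Real.Gamma (α + 1) * Real.Gamma (β + 1))) *
      appellF n (α + β + 1) (α + 1) (β + 1)
        ((Real.sin (θ / 2) * Real.sin (φ / 2)) ^ 2) ((Real.cos (θ / 2) * Real.cos (φ / 2)) ^ 2) := by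
  have hc : 0 < α + 1 := by linarith
  have hd : 0 < β + 1 := by linarith
  have p1 := (poch_pos hc n).ne'
  have p2 := (poch_pos hd n).ne'
  have p3 := (poch_add_self_pos (show -1 < α + β + 1 by linarith) n).ne'
  have p4 := (poch_pos (show 0 < α + β + 2 by linarith) (2 * n)).ne'
  have p5 := (Real.Gamma_pos_of_pos hc).ne'
  have p6 := (Real.Gamma_pos_of_pos hd).ne'
  have p7 := (Real.Gamma_pos_of_pos (show 0 < α + β + 2 by linarith)).ne'
  have h0 : 0 ≤ ∫ τ, jacobiP α β n (Real.cos τ) ^ 2 ∂jacobiMeasure α β :=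
    integral_nonneg fun _ => sq_nonneg _
  have hS := hypF_mul_hypF n hc hd (show α + 1 + (β + 1) = α + β + 1 + 1 by ring)
    (Real.sin (θ / 2) ^ 2) (Real.sin (φ / 2) ^ 2)
  rw [trigJacobi, trigJacobi, div_mul_div_comm, Real.mul_self_sqrt h0,
    integral_jacobiP_sq hα hβ, jacobiP_cos α β hα, jacobiP_cos α β hα, mul_pow, mul_pow,
    Real.cos_sq' (θ / 2), Real.cos_sq' (φ / 2), ← hS]
  have h1 : ((-1 : ℝ) ^ n) * (-1) ^ n = 1 := by rw [← mul_pow]; simp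
  field_simp
  linear_combination (- hypF n (α + β + 1) (α + 1) (Real.sin (θ / 2) ^ 2)
    * hypF n (α + β + 1) (α + 1) (Real.sin (φ / 2) ^ 2)) * h1

/-! ### Gegenbauer polynomials: generating function, recurrence and bounds. -/

section Gegenbauer

theorem poch_one (x : ℝ) : poch x 1 = x := by simp [poch]

/-- The coefficient `(s)_n / n!` of the binomial series of `(1 - z)^(-s)`. -/
def binCoef (s : ℝ) (n : ℕ) : ℝ := poch s n / (n.factorial : ℝ)

theorem binCoef_succ (s : ℝ) (n : ℕ) : (n + 1) * binCoef s (n + 1) = (s + n) * binCoef s n := by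
  rw [binCoef, binCoef, poch_succ, Nat.factorial_succ]
  push_cast
  field_simp

theorem binCoef_nonneg {s : ℝ} (hs : 0 < s) (n : ℕ) : 0 ≤ binCoef s n :=
  div_nonneg (poch_pos hs n).le (Nat.cast_nonneg _)

theorem multichoose_eq_binCoef (s : ℝ) (n : ℕ) :
    Ring.choose ((s : ℂ) + n - 1) n = (binCoef s n : ℂ) := by
  have h := Ring.factorial_nsmul_multichoose_eq_ascPochhammer (s : ℂ) n
  rw [Polynomial.ascPochhammer_smeval_eq_eval, nsmul_eq_mul] at h
  have h2 : Polynomial.eval (s : ℂ) (ascPochhammer ℂ n) = (poch s n : ℂ) := by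
    have := Polynomial.eval_map_apply (f := Complex.ofRealHom) (p := ascPochhammer ℝ n) s
    rw [ascPochhammer_map] at this
    simpa using this
  have h3 : (n.factorial : ℂ) ≠ 0 := by exact_mod_cast n.factorial_ne_zero
  rw [← Ring.multichoose_eq, binCoef, Complex.ofReal_div, ← h2, ← h]
  simp [h3]

theorem hasSum_binomial (s : ℝ) {z : ℂ} (hz : ‖z‖ < 1) :
    HasSum (fun n => (binCoef s n : ℂ) * z ^ n) (1 / (1 - z) ^ (s : ℂ)) ∧
    Summable fun n => ‖(binCoef s n : ℂ) * z ^ n‖ := by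
  have h := Complex.one_div_one_sub_cpow_hasFPowerSeriesOnBall_zero (s : ℂ)
  have hz' : z ∈ Metric.eball (0 : ℂ) 1 := by
    simpa [Metric.mem_eball, edist_zero_right, enorm_eq_nnnorm] using! hz
  have h1 := h.hasSum hz'
  have h2 := FormalMultilinearSeries.summable_norm_apply _ (Metric.eball_subset_eball h.r_le hz')
  simp only [FormalMultilinearSeries.ofScalars_apply_eq, multichoose_eq_binCoef, smul_eq_mul,
    zero_add] at h1 h2
  exact ⟨h1, h2⟩

/-- The coefficients of the product `(1 - z₁ X)^(-s) (1 - z₂ X)^(-s)`. -/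
def binProd (s : ℝ) (z₁ z₂ : ℂ) (n : ℕ) : ℂ :=
  ∑ kl ∈ antidiagonal n, (binCoef s kl.1 : ℂ) * z₁ ^ kl.1 * ((binCoef s kl.2 : ℂ) * z₂ ^ kl.2)

/-- The coefficients of `(1 - X)^(-s) (1 - X)^(-s)`. -/
def binSq (s : ℝ) (n : ℕ) : ℝ := ∑ kl ∈ antidiagonal n, binCoef s kl.1 * binCoef s kl.2

/-- For s > 0 all binomial coefficients are nonnegative, so on the unit circle the triangle
inequality compares with z₁ = z₂ = 1. -/
theorem norm_binProd_le {s : ℝ} (hs : 0 < s) {z₁ z₂ : ℂ} (h₁ : ‖z₁‖ = 1) (h₂ : ‖z₂‖ = 1) (n : ℕ) :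
    ‖binProd s z₁ z₂ n‖ ≤ binSq s n := by
  refine (norm_sum_le _ _).trans (sum_le_sum fun kl _ => ?_)
  simp only [norm_mul, norm_pow, h₁, h₂, one_pow, mul_one, Complex.norm_real, Real.norm_eq_abs,
    abs_of_nonneg (binCoef_nonneg hs _), le_refl]

theorem binProd_mul_pow (s : ℝ) (z₁ z₂ w : ℂ) (n : ℕ) : binProd s z₁ z₂ n * w ^ n =
    ∑ kl ∈ antidiagonal n,
      (binCoef s kl.1 : ℂ) * (z₁ * w) ^ kl.1 * ((binCoef s kl.2 : ℂ) * (z₂ * w) ^ kl.2) := by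
  rw [binProd, sum_mul]
  refine sum_congr rfl fun kl hkl => ?_
  rw [← mem_antidiagonal.1 hkl, pow_add, mul_pow, mul_pow]
  ring

theorem hasSum_binProd (s : ℝ) {z₁ z₂ w : ℂ} (h₁ : ‖z₁ * w‖ < 1) (h₂ : ‖z₂ * w‖ < 1) :
    HasSum (fun n => binProd s z₁ z₂ n * w ^ n)
      (1 / (1 - z₁ * w) ^ (s : ℂ) * (1 / (1 - z₂ * w) ^ (s : ℂ))) := by
  obtain ⟨a1, a2⟩ := hasSum_binomial s h₁
  obtain ⟨b1, b2⟩ := hasSum_binomial s h₂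
  simp only [binProd_mul_pow]
  rw [← a1.tsum_eq, ← b1.tsum_eq, tsum_mul_tsum_eq_tsum_sum_antidiagonal_of_summable_norm a2 b2]
  exact (summable_norm_sum_mul_antidiagonal_of_summable_norm a2 b2).of_norm.hasSum

theorem summable_binSq (s : ℝ) {r : ℝ} (hr0 : 0 ≤ r) (hr : r < 1) :
    Summable fun n => binSq s n * r ^ n := by
  have h := (hasSum_binProd s (z₁ := 1) (z₂ := 1) (w := (r : ℂ))
    (by simpa [abs_of_nonneg hr0]) (by simpa [abs_of_nonneg hr0])).summable
  have e : (fun n => binProd s 1 1 n * (r : ℂ) ^ n) = fun n => ((binSq s n * r ^ n : ℝ) : ℂ) := by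
    ext n
    simp [binProd, binSq]
  rw [e] at h
  exact Complex.summable_ofReal.1 h

section Recurrence

open PowerSeries

/-- The binomial power series of `(1 - z X)^(-s)`. -/
def binSeries (s : ℝ) (z : ℂ) : ℂ⟦X⟧ := PowerSeries.mk fun n => (binCoef s n : ℂ) * z ^ n

theorem derivative_binSeries (s : ℝ) (z : ℂ) :
    (1 - C z * X) * derivative ℂ (binSeries s z) = C (s * z) * binSeries s z := by
  ext n
  have h := congrArg (fun x : ℝ => (x : ℂ)) (binCoef_succ s n)
  rw [sub_mul, one_mul, mul_assoc, map_sub, coeff_C_mul, coeff_C_mul, coeff_derivative]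
  cases n with
  | zero =>
    simp [binSeries] at h ⊢
    rw [h]; ring
  | succ n =>
    simp only [coeff_succ_X_mul, coeff_derivative, binSeries, coeff_mk]
    push_cast at h ⊢
    linear_combination z ^ (n + 1 + 1) * h

theorem coeff_binSeries_mul (s : ℝ) (z₁ z₂ : ℂ) (n : ℕ) :
    coeff n (binSeries s z₁ * binSeries s z₂) = binProd s z₁ z₂ n := by
  simp [coeff_mul, binSeries, binProd]

theorem binProd_zero (s : ℝ) (z₁ z₂ : ℂ) : binProd s z₁ z₂ 0 = 1 := by
  simp [binProd, binCoef, poch_zero]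

theorem binProd_one (s : ℝ) (z₁ z₂ : ℂ) : binProd s z₁ z₂ 1 = s * (z₁ + z₂) := by
  simp [binProd, binCoef, poch_zero, poch_one, Finset.Nat.antidiagonal_succ]
  ring

/-- The product B of the two binomial series satisfies (1 - 2wX + X²) B' = 2s (w - X) B; the
recurrence is the coefficient of X^{n+1}. -/
theorem binProd_add_two (s : ℝ) {z₁ z₂ w : ℂ} (h : z₁ * z₂ = 1) (hw : z₁ + z₂ = 2 * w) (n : ℕ) :
    (n + 2) * binProd s z₁ z₂ (n + 2) =
      2 * w * (n + 1 + s) * binProd s z₁ z₂ (n + 1) - (n + 2 * s) * binProd s z₁ z₂ n := by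
  set B := binSeries s z₁ * binSeries s z₂ with hB
  have h1 := derivative_binSeries s z₁
  have h2 := derivative_binSeries s z₂
  have hC : C z₁ * C z₂ = 1 := by rw [← map_mul, h, map_one]
  have hD : C z₁ + C z₂ = 2 * C w := by
    rw [← map_add, hw, map_mul, map_ofNat]
  have h3 : derivative ℂ B - 2 * (C w * (X * derivative ℂ B)) + X * (X * derivative ℂ B)
      = C (s * (2 * w)) * B - C (2 * s : ℂ) * (X * B) := by
    have hd : derivative ℂ B = binSeries s z₁ * derivative ℂ (binSeries s z₂)
        + binSeries s z₂ * derivative ℂ (binSeries s z₁) := by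
      rw [hB, Derivation.leibniz, smul_eq_mul, smul_eq_mul]
    rw [hd, hB]
    simp only [map_mul, map_ofNat] at *
    linear_combination (1 - C z₂ * X) * binSeries s z₂ * h1
      + (1 - C z₁ * X) * binSeries s z₁ * h2
      + (- C (s : ℂ) * binSeries s z₁ * binSeries s z₂ * 2 * X
        - X ^ 2 * binSeries s z₁ * derivative ℂ (binSeries s z₂)
        - X ^ 2 * binSeries s z₂ * derivative ℂ (binSeries s z₁)) * hC
      + (C (s : ℂ) * binSeries s z₁ * binSeries s z₂
        + X * binSeries s z₁ * derivative ℂ (binSeries s z₂)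
        + X * binSeries s z₂ * derivative ℂ (binSeries s z₁)) * hD
  have h4 := congrArg (coeff (n + 1)) h3
  rw [show (2 : ℂ⟦X⟧) = C 2 from (map_ofNat C 2).symm] at h4
  simp only [map_add, map_sub, coeff_C_mul, coeff_succ_X_mul, coeff_derivative] at h4
  have hX : coeff n (X * derivative ℂ B) = n * coeff n B := by
    cases n with
    | zero => simp
    | succ n => rw [coeff_succ_X_mul, coeff_derivative]; push_cast; ring
  rw [hX, hB] at h4
  simp only [coeff_binSeries_mul] at h4
  push_cast at h4
  linear_combination h4

end Recurrence

/-- `1 / (n - m)!`, and `0` for `m > n`. -/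
def invFactSub (n m : ℕ) : ℝ := (n.choose m : ℝ) * (m.factorial : ℝ) / (n.factorial : ℝ)

theorem invFactSub_eq_zero {n m : ℕ} (h : n < m) : invFactSub n m = 0 := by
  simp [invFactSub, Nat.choose_eq_zero_of_lt h]

theorem invFactSub_succ_succ (n m : ℕ) : invFactSub (n + 1) (m + 1) = invFactSub n m := by
  have h := congrArg (Nat.cast (R := ℝ)) (Nat.add_one_mul_choose_eq n m)
  push_cast at h
  rw [invFactSub, invFactSub, Nat.factorial_succ, Nat.factorial_succ]
  push_cast
  field_simp
  linear_combination -h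

theorem invFactSub_succ (n m : ℕ) :
    invFactSub (n + 1) m * (n + 1 - m) = invFactSub n m := by
  have h := congrArg (Nat.cast (R := ℝ)) (Nat.choose_mul_succ_eq n m)
  push_cast at h
  rw [invFactSub, invFactSub, Nat.factorial_succ]
  rcases le_or_gt m (n + 1) with hm | hm
  · rw [Nat.cast_sub hm] at h
    push_cast at h ⊢
    field_simp
    linear_combination -h
  · simp [Nat.choose_eq_zero_of_lt hm, Nat.choose_eq_zero_of_lt (show n < m by omega)]

/-- Coefficients of the Gegenbauer polynomial `C_{2n}^s(w)` in powers of `2w`. -/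
def evenCoef (s : ℝ) (n m : ℕ) : ℝ :=
  (-1) ^ (n + m) * poch s (n + m) * invFactSub n m / ((2 * m).factorial : ℝ)

/-- Coefficients of the Gegenbauer polynomial `C_{2n+1}^s(w)` in powers of `2w`. -/
def oddCoef (s : ℝ) (n m : ℕ) : ℝ :=
  (-1) ^ (n + m) * poch s (n + m + 1) * invFactSub n m / ((2 * m + 1).factorial : ℝ)

/-- The Gegenbauer polynomial `C_{2n}^s(w)`. -/
def gegenEven (s : ℝ) (n : ℕ) (w : ℝ) : ℝ :=
  ∑ m ∈ range (n + 1), evenCoef s n m * (2 * w) ^ (2 * m)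

/-- The Gegenbauer polynomial `C_{2n+1}^s(w)`. -/
def gegenOdd (s : ℝ) (n : ℕ) (w : ℝ) : ℝ :=
  ∑ m ∈ range (n + 1), oddCoef s n m * (2 * w) ^ (2 * m + 1)

theorem gegenEven_succ (s : ℝ) (n : ℕ) (w : ℝ) : (2 * n + 2) * gegenEven s (n + 1) w =
    2 * w * (2 * n + 1 + s) * gegenOdd s n w - (2 * n + 2 * s) * gegenEven s n w := by
  have h0 : gegenEven s n w = ∑ m ∈ range (n + 1), evenCoef s n (m + 1) * (2 * w) ^ (2 * (m + 1))
      + evenCoef s n 0 := by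
    rw [gegenEven, sum_range_succ', sum_range_succ]
    have : evenCoef s n (n + 1) = 0 := by simp [evenCoef, invFactSub_eq_zero]
    simp [this]
  rw [h0, gegenEven, sum_range_succ', gegenOdd]
  have h1 : (2 * n + 2) * evenCoef s (n + 1) 0 = -((2 * n + 2 * s) * evenCoef s n 0) := by
    simp only [evenCoef, ← invFactSub_succ n 0]
    simp only [add_zero, pow_succ, poch_succ]
    push_cast
    ring
  have h2 : ∀ m, (2 * n + 2) * evenCoef s (n + 1) (m + 1) =
      (2 * n + 1 + s) * oddCoef s n m - (2 * n + 2 * s) * evenCoef s n (m + 1) := by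
    intro m
    simp only [evenCoef, oddCoef, ← invFactSub_succ n (m + 1), ← invFactSub_succ_succ n m]
    rw [show n + 1 + (m + 1) = n + m + 1 + 1 by ring, show n + (m + 1) = n + m + 1 by ring,
      show 2 * (m + 1) = 2 * m + 1 + 1 by ring, Nat.factorial_succ (2 * m + 1),
      poch_succ s (n + m + 1), pow_succ _ (n + m + 1), pow_succ _ (n + m)]
    push_cast
    field_simp
    ring
  simp only [mul_zero, pow_zero, mul_one]
  rw [mul_add, mul_add (2 * (n : ℝ) + 2 * s), h1, mul_sum, mul_sum, mul_sum]
  have : ∀ m ∈ range (n + 1), (2 * (n : ℝ) + 2) *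
      (evenCoef s (n + 1) (m + 1) * (2 * w) ^ (2 * (m + 1))) =
      2 * w * (2 * n + 1 + s) * (oddCoef s n m * (2 * w) ^ (2 * m + 1)) -
      (2 * n + 2 * s) * (evenCoef s n (m + 1) * (2 * w) ^ (2 * (m + 1))) := by
    intro m _
    rw [show 2 * (m + 1) = 2 * m + 1 + 1 by ring, pow_succ _ (2 * m + 1)]
    linear_combination (2 * w) ^ (2 * m + 1) * (2 * w) * h2 m
  rw [sum_congr rfl this, sum_sub_distrib]
  ring

theorem gegenOdd_succ (s : ℝ) (n : ℕ) (w : ℝ) : (2 * n + 3) * gegenOdd s (n + 1) w =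
    2 * w * (2 * n + 2 + s) * gegenEven s (n + 1) w - (2 * n + 1 + 2 * s) * gegenOdd s n w := by
  have h0 : gegenOdd s n w = ∑ m ∈ range (n + 1 + 1), oddCoef s n m * (2 * w) ^ (2 * m + 1) := by
    rw [gegenOdd, sum_range_succ _ (n + 1), oddCoef, invFactSub_eq_zero (Nat.lt_succ_self n)]
    simp
  rw [h0, gegenEven, gegenOdd, mul_sum, mul_sum, mul_sum, ← sum_sub_distrib]
  refine sum_congr rfl fun m _ => ?_
  have h2 : (2 * n + 3) * oddCoef s (n + 1) m =
      (2 * n + 2 + s) * evenCoef s (n + 1) m - (2 * n + 1 + 2 * s) * oddCoef s n m := by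
    simp only [evenCoef, oddCoef, ← invFactSub_succ n m]
    rw [show n + 1 + m = n + m + 1 by ring, Nat.factorial_succ (2 * m),
      poch_succ s (n + m + 1), pow_succ _ (n + m)]
    push_cast
    field_simp
    ring
  rw [pow_succ _ (2 * m)]
  linear_combination (2 * w) ^ (2 * m) * (2 * w) * h2

/-- Both sides have the same values in degrees 0 and 1 and obey the same three-term recurrence. The
complex form yields the bounds and the generating function, the explicit form the integrals. -/
theorem binProd_eq_gegen (s : ℝ) {z₁ z₂ : ℂ} {w : ℝ} (h : z₁ * z₂ = 1) (hw : z₁ + z₂ = 2 * w)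
    (n : ℕ) : binProd s z₁ z₂ (2 * n) = (gegenEven s n w : ℂ) ∧
      binProd s z₁ z₂ (2 * n + 1) = (gegenOdd s n w : ℂ) := by
  induction n with
  | zero =>
    simp [binProd_zero, binProd_one, hw, gegenEven, gegenOdd, evenCoef, oddCoef, invFactSub,
      poch_zero, poch_one]
  | succ n ih =>
    have e1 := binProd_add_two s h hw (2 * n)
    have e2 := binProd_add_two s h hw (2 * n + 1)
    rw [ih.1, ih.2] at e1
    have g1 := congrArg (fun x : ℝ => (x : ℂ)) (gegenEven_succ s n w)
    have g2 := congrArg (fun x : ℝ => (x : ℂ)) (gegenOdd_succ s n w)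
    push_cast at e1 e2 g1 g2
    have n1 : (2 * (n : ℂ) + 2) ≠ 0 := by
      have : ((2 * n + 2 : ℕ) : ℂ) ≠ 0 := Nat.cast_ne_zero.2 (by omega)
      exact_mod_cast this
    have n2 : (2 * (n : ℂ) + 3) ≠ 0 := by
      have : ((2 * n + 3 : ℕ) : ℂ) ≠ 0 := Nat.cast_ne_zero.2 (by omega)
      exact_mod_cast this
    have r1 : binProd s z₁ z₂ (2 * (n + 1)) = (gegenEven s (n + 1) w : ℂ) := by
      rw [← mul_right_inj' n1, show 2 * (n + 1) = 2 * n + 2 by ring, e1, g1]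
    refine ⟨r1, ?_⟩
    rw [show 2 * n + 1 + 1 = 2 * (n + 1) by ring, r1, ih.2] at e2
    rw [← mul_right_inj' n2, show 2 * (n + 1) + 1 = 2 * n + 1 + 2 by ring, g2]
    linear_combination e2

theorem exists_unit_conj {w : ℝ} (hw : |w| ≤ 1) : ∃ z : ℂ, ‖z‖ = 1 ∧
    z * (starRingEnd ℂ) z = 1 ∧ z + (starRingEnd ℂ) z = 2 * w ∧ z.re = w := by
  rw [abs_le] at hw
  refine ⟨Complex.exp (Real.arccos w * Complex.I), Complex.norm_exp_ofReal_mul_I _, ?_, ?_, ?_⟩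
  · rw [Complex.mul_conj, Complex.normSq_eq_norm_sq, Complex.norm_exp_ofReal_mul_I]; simp
  · rw [Complex.add_conj, Complex.exp_ofReal_mul_I_re, Real.cos_arccos hw.1 hw.2]; simp
  · rw [Complex.exp_ofReal_mul_I_re, Real.cos_arccos hw.1 hw.2]

theorem abs_gegenEven_le {s : ℝ} (hs : 0 < s) (n : ℕ) {w : ℝ} (hw : |w| ≤ 1) :
    |gegenEven s n w| ≤ binSq s (2 * n) := by
  obtain ⟨z, h1, h2, h3, -⟩ := exists_unit_conj hw
  have := norm_binProd_le hs h1 (z₂ := (starRingEnd ℂ) z) (by simpa) (2 * n)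
  rwa [(binProd_eq_gegen s h2 h3 n).1, Complex.norm_real, Real.norm_eq_abs] at this

/-- A positive real part keeps x off the branch cut, so the power commutes with conjugation. -/
theorem one_div_cpow_mul_conj (s : ℝ) {x : ℂ} (hx : 0 < x.re) :
    1 / x ^ (s : ℂ) * (1 / (starRingEnd ℂ) x ^ (s : ℂ)) = ((Complex.normSq x ^ (-s) : ℝ) : ℂ) := by
  have hx0 : x ≠ 0 := by rintro rfl; simp at hx
  have harg : x.arg ≠ Real.pi := by
    intro h
    rw [Complex.arg_eq_pi_iff] at h
    linarith [h.1]
  have h1 : (starRingEnd ℂ) x ^ (s : ℂ) = (starRingEnd ℂ) (x ^ (s : ℂ)) := by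
    rw [Complex.conj_cpow x _ harg, Complex.conj_ofReal]
  rw [h1, div_mul_div_comm, Complex.mul_conj, Complex.normSq_eq_norm_sq (x ^ (s : ℂ)),
    Complex.norm_cpow_of_ne_zero hx0, Complex.normSq_eq_norm_sq]
  simp only [Complex.ofReal_re, Complex.ofReal_im, mul_zero, Real.exp_zero, div_one]
  rw [Real.rpow_neg (by positivity), ← Real.rpow_natCast, ← Real.rpow_natCast,
    ← Real.rpow_mul (norm_nonneg _), ← Real.rpow_mul (norm_nonneg _), mul_comm s]
  push_cast
  simp

theorem hasSum_binProd_conj (s : ℝ) {z : ℂ} (hz : ‖z‖ = 1) {r : ℝ} (hr : |r| < 1) :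
    HasSum (fun n => binProd s z ((starRingEnd ℂ) z) n * (r : ℂ) ^ n)
      (((1 - 2 * z.re * r + r ^ 2) ^ (-s) : ℝ) : ℂ) := by
  have hn : ‖z * r‖ < 1 := by simpa [hz] using hr
  have h := hasSum_binProd s (z₁ := z) (z₂ := (starRingEnd ℂ) z) (w := (r : ℂ)) hn
    (by simpa [hz] using hr)
  have e : 1 - (starRingEnd ℂ) z * r = (starRingEnd ℂ) (1 - z * r) := by simp
  have hre : 0 < (1 - z * r : ℂ).re := by
    have := (Complex.abs_re_le_norm (z * r)).trans_lt hn
    rw [abs_lt] at this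
    rw [Complex.sub_re, Complex.one_re]
    linarith
  rw [e, one_div_cpow_mul_conj s hre] at h
  convert h using 3
  have h1 : z.re * z.re + z.im * z.im = 1 := by
    have := Complex.normSq_eq_norm_sq z
    rw [hz, Complex.normSq_apply] at this
    simpa using this
  rw [Complex.normSq_apply]
  simp
  linear_combination (- r ^ 2) * h1

/-- The generating function of the Gegenbauer polynomials of even degree. -/
theorem hasSum_gegenEven (s : ℝ) {w r : ℝ} (hw : |w| ≤ 1) (hr : |r| < 1) :
    HasSum (fun n => gegenEven s n w * r ^ (2 * n))
      (((1 - 2 * w * r + r ^ 2) ^ (-s) + (1 + 2 * w * r + r ^ 2) ^ (-s)) / 2) := by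
  obtain ⟨z, h1, h2, h3, h4⟩ := exists_unit_conj hw
  have a := hasSum_binProd_conj s h1 hr
  have b := hasSum_binProd_conj s h1 (r := -r) (by simpa)
  -- Averaging over r and -r removes the odd degrees.
  have c := (a.add b).div_const 2
  have hinj : Function.Injective fun n : ℕ => 2 * n := fun a b h => by simpa using h
  rw [← hinj.hasSum_iff] at c
  · rw [← Complex.hasSum_ofReal]
    rw [h4] at c
    have e1 : (fun n => ((gegenEven s n w * r ^ (2 * n) : ℝ) : ℂ)) = (fun i =>
        (binProd s z ((starRingEnd ℂ) z) i * (r : ℂ) ^ i +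
          binProd s z ((starRingEnd ℂ) z) i * ((-r : ℝ) : ℂ) ^ i) / 2) ∘ fun n => 2 * n := by
      ext n
      simp only [Function.comp_apply, Complex.ofReal_neg]
      rw [Even.neg_pow (even_two_mul n), (binProd_eq_gegen s h2 h3 n).1]
      push_cast
      ring
    rw [e1]
    rw [show 1 + 2 * w * r + r ^ 2 = 1 - 2 * w * -r + (-r) ^ 2 by ring]
    exact_mod_cast c
  · intro n hn
    have : Odd n := by
      rw [← Nat.not_even_iff_odd]
      rintro ⟨k, hk⟩
      exact hn ⟨k, by simp; omega⟩
    simp [this.neg_pow]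

end Gegenbauer

/-! ### Mean value bounds for mixed second differences. -/

section SecondDifference

theorem abs_sub_le_of_hasDerivAt {f f' : ℝ → ℝ} {a b K : ℝ} (hf : ∀ x, HasDerivAt f (f' x) x)
    (hK : ∀ x ∈ Set.Icc a b, |f' x| ≤ K) {x y : ℝ} (hx : x ∈ Set.Icc a b) (hy : y ∈ Set.Icc a b) :
    |f x - f y| ≤ K * |x - y| := by
  have := (convex_Icc a b).norm_image_sub_le_of_norm_hasDerivWithin_le
    (fun x _ => (hf x).hasDerivWithinAt) hK hy hx
  simpa using this

/-- The even part in `v` of `f (u a + v b)`. -/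
def evenPart (f : ℝ → ℝ) (a b u v : ℝ) : ℝ := (f (u * a + v * b) + f (u * a - v * b)) / 2

/-- The mixed second difference of `F` at `(u, v)` and `(1, 1)`. -/
def secondDiff (F : ℝ → ℝ → ℝ) (u v : ℝ) : ℝ := F u v - F u 1 - F 1 v + F 1 1

variable {f f' f'' : ℝ → ℝ} {a b M : ℝ}

theorem mem_Icc_of_weights (ha : 0 ≤ a) (hb : 0 ≤ b) (hab : a + b ≤ 1) {u v : ℝ}
    (hu : u ∈ Set.Icc (0 : ℝ) 1) (hv : v ∈ Set.Icc (0 : ℝ) 1) :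
    u * a + v * b ∈ Set.Icc (-1 : ℝ) 1 ∧ u * a - v * b ∈ Set.Icc (-1 : ℝ) 1 := by
  have h1 := mul_nonneg hu.1 ha
  have h2 := mul_nonneg hv.1 hb
  have h3 := mul_le_of_le_one_left ha hu.2
  have h4 := mul_le_of_le_one_left hb hv.2
  exact ⟨⟨by linarith, by linarith⟩, ⟨by linarith, by linarith⟩⟩

/-- The mean value theorem in u, followed by the Lipschitz bound for f' in v, gives the product
(1-u)(1-v). Because f'(0) = 0, the bound M on f'' also bounds f' on [-1,1], so one constant serves
all three differences. -/
theorem evenPart_bounds (h1 : ∀ x, HasDerivAt f (f' x) x) (h2 : ∀ x, HasDerivAt f' (f'' x) x)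
    (h0 : f' 0 = 0) (hM : ∀ x ∈ Set.Icc (-1 : ℝ) 1, |f'' x| ≤ M)
    (ha : 0 ≤ a) (hb : 0 ≤ b) (hab : a + b ≤ 1) {u v : ℝ}
    (hu : u ∈ Set.Icc (0 : ℝ) 1) (hv : v ∈ Set.Icc (0 : ℝ) 1) :
    |secondDiff (evenPart f a b) u v| ≤ M * ((1 - u) * (1 - v)) ∧
    |evenPart f a b u 1 - evenPart f a b 1 1| ≤ M * (1 - u) ∧
    |evenPart f a b 1 v - evenPart f a b 1 1| ≤ M * (1 - v) := by
  have hM0 : 0 ≤ M := (abs_nonneg _).trans (hM 0 (by norm_num))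
  have one : (1 : ℝ) ∈ Set.Icc (0 : ℝ) 1 := by norm_num
  have lip : ∀ x ∈ Set.Icc (-1 : ℝ) 1, ∀ y ∈ Set.Icc (-1 : ℝ) 1, |f' x - f' y| ≤ M * |x - y| :=
    fun x hx y hy => abs_sub_le_of_hasDerivAt h2 hM hx hy
  have hf' : ∀ x ∈ Set.Icc (-1 : ℝ) 1, |f' x| ≤ M := by
    intro x hx
    have := lip x hx 0 (by norm_num)
    rw [h0, sub_zero, sub_zero] at this
    exact this.trans (mul_le_of_le_one_right hM0 (abs_le.2 ⟨by linarith [hx.1], hx.2⟩))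
  have ha1 : a ≤ 1 := by linarith
  have hb1 : b ≤ 1 := by linarith
  have dU : ∀ v x : ℝ, HasDerivAt (fun u => evenPart f a b u v)
      ((f' (x * a + v * b) * a + f' (x * a - v * b) * a) / 2) x := by
    intro v x
    have e1 : HasDerivAt (fun u : ℝ => u * a + v * b) a x := by
      simpa using ((hasDerivAt_id x).mul_const a).add_const (v * b)
    have e2 : HasDerivAt (fun u : ℝ => u * a - v * b) a x := by
      simpa using ((hasDerivAt_id x).mul_const a).sub_const (v * b)
    exact (((h1 _).comp x e1).add ((h1 _).comp x e2)).div_const 2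
  have dV : ∀ u x : ℝ, HasDerivAt (fun v => evenPart f a b u v)
      ((f' (u * a + x * b) * b - f' (u * a - x * b) * b) / 2) x := by
    intro v x
    have e1 : HasDerivAt (fun u : ℝ => v * a + u * b) b x := by
      simpa using ((hasDerivAt_id x).mul_const b).const_add (v * a)
    have e2 : HasDerivAt (fun u : ℝ => v * a - u * b) (-b) x := by
      simpa using ((hasDerivAt_id x).mul_const b).const_sub (v * a)
    refine ((((h1 _).comp x e1).add ((h1 _).comp x e2)).div_const 2).congr_deriv ?_
    ring
  have au : |u - 1| = 1 - u := by rw [abs_sub_comm, abs_of_nonneg]; linarith [hu.2]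
  have av : |v - 1| = 1 - v := by rw [abs_sub_comm, abs_of_nonneg]; linarith [hv.2]
  have hv0 : 0 ≤ 1 - v := by linarith [hv.2]
  refine ⟨?_, ?_, ?_⟩
  · have key := abs_sub_le_of_hasDerivAt (a := 0) (b := 1) (K := M * (1 - v))
      (fun x => (dU v x).sub (dU 1 x)) ?_ hu one
    · rw [au] at key
      convert key using 1
      · simp only [secondDiff, Pi.sub_apply]; congr 1; ring
      · ring
    · intro x hx
      obtain ⟨m1, m2⟩ := mem_Icc_of_weights ha hb hab hx hv
      obtain ⟨m3, m4⟩ := mem_Icc_of_weights ha hb hab hx one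
      have l1 := lip _ m1 _ m3
      have l2 := lip _ m2 _ m4
      rw [show x * a + v * b - (x * a + 1 * b) = (v - 1) * b by ring, abs_mul, av,
        abs_of_nonneg hb] at l1
      rw [show x * a - v * b - (x * a - 1 * b) = -((v - 1) * b) by ring, abs_neg, abs_mul, av,
        abs_of_nonneg hb] at l2
      have l3 : M * ((1 - v) * b) ≤ M * (1 - v) :=
        mul_le_mul_of_nonneg_left (mul_le_of_le_one_right hv0 hb1) hM0
      have l4 := abs_add_le (f' (x * a + v * b) - f' (x * a + 1 * b))
        (f' (x * a - v * b) - f' (x * a - 1 * b))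
      rw [show ((f' (x * a + v * b) * a + f' (x * a - v * b) * a) / 2 -
          (f' (x * a + 1 * b) * a + f' (x * a - 1 * b) * a) / 2) =
          (((f' (x * a + v * b) - f' (x * a + 1 * b)) +
            (f' (x * a - v * b) - f' (x * a - 1 * b))) / 2) * a by ring, abs_mul,
        abs_of_nonneg ha, abs_div, abs_two]
      refine (mul_le_of_le_one_right (by positivity) ha1).trans ?_
      linarith
  · have key := abs_sub_le_of_hasDerivAt (a := 0) (b := 1) (K := M) (dU 1) ?_ hu one
    · rwa [au] at key
    · intro x hx
      obtain ⟨m3, m4⟩ := mem_Icc_of_weights ha hb hab hx one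
      have l4 := abs_add_le (f' (x * a + 1 * b)) (f' (x * a - 1 * b))
      rw [← add_mul, mul_div_right_comm, abs_mul, abs_of_nonneg ha, abs_div, abs_two]
      refine (mul_le_of_le_one_right (by positivity) ha1).trans ?_
      linarith [hf' _ m3, hf' _ m4]
  · have key := abs_sub_le_of_hasDerivAt (a := 0) (b := 1) (K := M) (dV 1) ?_ hv one
    · rwa [av] at key
    · intro x hx
      obtain ⟨m3, m4⟩ := mem_Icc_of_weights ha hb hab one hx
      have l4 := abs_sub (f' (1 * a + x * b)) (f' (1 * a - x * b))
      rw [← sub_mul, mul_div_right_comm, abs_mul, abs_of_nonneg hb, abs_div, abs_two]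
      refine (mul_le_of_le_one_right (by positivity) hb1).trans ?_
      linarith [hf' _ m3, hf' _ m4]

end SecondDifference

/-! ### Second derivatives of the even Gegenbauer polynomials. -/

section GegenbauerDerivative

open Polynomial

/-- `gegenEven` as a polynomial. -/
def gegenPoly (s : ℝ) (n : ℕ) : ℝ[X] :=
  ∑ m ∈ range (n + 1), C (evenCoef s n m * 4 ^ m) * X ^ (2 * m)

theorem eval_gegenPoly (s : ℝ) (n : ℕ) (w : ℝ) : (gegenPoly s n).eval w = gegenEven s n w := by
  simp only [gegenPoly, gegenEven, eval_finsetSum, eval_mul, eval_C, eval_pow, eval_X, mul_pow]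
  refine sum_congr rfl fun m _ => ?_
  rw [pow_mul 2 2 m]
  norm_num
  ring

theorem coeff_one_gegenPoly (s : ℝ) (n : ℕ) : (gegenPoly s n).coeff 1 = 0 := by
  rw [gegenPoly, finsetSum_coeff]
  refine sum_eq_zero fun m _ => ?_
  rw [coeff_C_mul, coeff_X_pow, if_neg (by omega), mul_zero]

theorem evenCoef_succ_succ (s : ℝ) (n m : ℕ) :
    evenCoef s (n + 1) (m + 1) * ((2 * m + 2) * (2 * m + 1)) =
      s * (s + 1) * evenCoef (s + 2) n m := by
  rw [evenCoef, evenCoef, invFactSub_succ_succ, show n + 1 + (m + 1) = n + m + 1 + 1 by ring,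
    poch_succ_left, poch_succ_left, show 2 * (m + 1) = 2 * m + 1 + 1 by ring,
    Nat.factorial_succ (2 * m + 1), Nat.factorial_succ, show s + 1 + 1 = s + 2 by ring, pow_succ,
    pow_succ]
  push_cast
  field_simp
  ring

/-- Two derivatives shift the parameter s to s + 2 and lower the degree by two, so the sup bound for
Gegenbauer polynomials applies again. -/
theorem derivative_derivative_gegenPoly (s : ℝ) (n : ℕ) :
    derivative (derivative (gegenPoly s (n + 1))) = C (4 * s * (s + 1)) * gegenPoly (s + 2) n := by
  rw [gegenPoly, sum_range_succ', gegenPoly, mul_sum, derivative_add, derivative_add,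
    derivative_sum, derivative_sum]
  simp only [mul_zero, pow_zero, mul_one, derivative_C, derivative_zero, add_zero]
  refine sum_congr rfl fun m _ => ?_
  rw [show 2 * (m + 1) = 2 * m + 1 + 1 by ring, derivative_C_mul, derivative_X_pow,
    ← mul_assoc, ← C_mul, derivative_C_mul, Nat.add_sub_cancel, derivative_X_pow,
    Nat.add_sub_cancel, ← mul_assoc, ← C_mul, ← mul_assoc, ← C_mul]
  congr 2
  push_cast
  rw [pow_succ]
  linear_combination (4 ^ m * 4) * evenCoef_succ_succ s n m

/-- A bound for the second derivative of `gegenEven s n` on `[-1, 1]`. -/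
def gegenBound (s : ℝ) : ℕ → ℝ
  | 0 => 0
  | n + 1 => 4 * s * (s + 1) * binSq (s + 2) (2 * n)

theorem abs_derivative_derivative_gegenPoly_le {s : ℝ} (hs : 0 < s) (n : ℕ) {w : ℝ}
    (hw : w ∈ Set.Icc (-1 : ℝ) 1) :
    |(derivative (derivative (gegenPoly s n))).eval w| ≤ gegenBound s n := by
  cases n with
  | zero => simp [gegenPoly, gegenBound]
  | succ n =>
    rw [derivative_derivative_gegenPoly, eval_mul, eval_C, eval_gegenPoly, abs_mul,
      abs_of_nonneg (by positivity), gegenBound]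
    exact mul_le_mul_of_nonneg_left (abs_gegenEven_le (by positivity) n (abs_le.2 hw))
      (by positivity)

theorem summable_gegenBound (s : ℝ) {r : ℝ} (hr0 : 0 ≤ r) (hr : r < 1) :
    Summable fun n => gegenBound s n * r ^ (2 * n) := by
  rw [← summable_nat_add_iff 1]
  have h := (summable_binSq (s + 2) hr0 hr).comp_injective
    (i := fun n : ℕ => 2 * n) (fun a b h => by simpa using h)
  refine (h.mul_left (4 * s * (s + 1) * r ^ 2)).congr fun n => ?_
  simp only [Function.comp_apply, gegenBound]
  ring

theorem evenPart_gegenEven_bounds {s : ℝ} (hs : 0 < s) (n : ℕ) {a b : ℝ}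
    (ha : 0 ≤ a) (hb : 0 ≤ b) (hab : a + b ≤ 1) {u v : ℝ}
    (hu : u ∈ Set.Icc (0 : ℝ) 1) (hv : v ∈ Set.Icc (0 : ℝ) 1) :
    |secondDiff (evenPart (gegenEven s n) a b) u v| ≤ gegenBound s n * ((1 - u) * (1 - v)) ∧
    |evenPart (gegenEven s n) a b u 1 - evenPart (gegenEven s n) a b 1 1|
      ≤ gegenBound s n * (1 - u) ∧
    |evenPart (gegenEven s n) a b 1 v - evenPart (gegenEven s n) a b 1 1|
      ≤ gegenBound s n * (1 - v) := by
  have e : gegenEven s n = fun w => (gegenPoly s n).eval w :=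
    funext fun w => (eval_gegenPoly s n w).symm
  rw [e]
  refine evenPart_bounds (fun x => (gegenPoly s n).hasDerivAt x)
    (fun x => (derivative (gegenPoly s n)).hasDerivAt x) ?_
    (fun x hx => abs_derivative_derivative_gegenPoly_le hs n hx) ha hb hab hu hv
  rw [← coeff_zero_eq_eval_zero, coeff_derivative, coeff_one_gegenPoly, zero_mul]

theorem continuous_gegenEven (s : ℝ) (n : ℕ) : Continuous (gegenEven s n) := by
  unfold gegenEven
  fun_prop

end GegenbauerDerivative

/-! ### The measures dΠ_γ and their regularised moments. -/

section PiMeasure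

theorem image_sq_Ioo : (fun u : ℝ => u ^ 2) '' Set.Ioo 0 1 = Set.Ioo 0 1 := by
  ext y
  constructor
  · rintro ⟨u, hu, rfl⟩
    exact ⟨pow_pos hu.1 2, pow_lt_one₀ hu.1.le hu.2 two_ne_zero⟩
  · rintro ⟨h0, h1⟩
    exact ⟨Real.sqrt y, ⟨Real.sqrt_pos.2 h0, by rw [Real.sqrt_lt' one_pos]; simpa⟩,
      Real.sq_sqrt h0.le⟩

theorem betaIntegrand_sq (a b : ℝ) {u : ℝ} (hu : u ∈ Set.Ioo (0 : ℝ) 1) :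
    |2 * u| • ((u ^ 2) ^ (a - 1) * (1 - u ^ 2) ^ (b - 1))
      = 2 * (u ^ (2 * a - 1) * (1 - u ^ 2) ^ (b - 1)) := by
  have hu0 := hu.1
  rw [abs_of_pos (by positivity), smul_eq_mul, ← Real.rpow_natCast u 2, ← Real.rpow_mul hu0.le,
    show 2 * a - 1 = ((2 : ℕ) : ℝ) * (a - 1) + 1 by push_cast; ring, Real.rpow_add hu0,
    Real.rpow_one]
  ring

/-- The Beta integral in the variable `u`, with `y = u²`. -/
theorem betaIntegrand_sq_integral {a b : ℝ} (ha : 0 < a) (hb : 0 < b) :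
    IntegrableOn (fun u : ℝ => u ^ (2 * a - 1) * (1 - u ^ 2) ^ (b - 1)) (Set.Ioo 0 1) ∧
    2 * ∫ u in Set.Ioo (0 : ℝ) 1, u ^ (2 * a - 1) * (1 - u ^ 2) ^ (b - 1)
      = Real.Gamma a * Real.Gamma b / Real.Gamma (a + b) := by
  have hd : ∀ u ∈ Set.Ioo (0 : ℝ) 1,
      HasDerivWithinAt (fun u : ℝ => u ^ 2) (2 * u) (Set.Ioo 0 1) u := by
    intro u _
    simpa using (hasDerivAt_pow 2 u).hasDerivWithinAt
  have hinj : Set.InjOn (fun u : ℝ => u ^ 2) (Set.Ioo 0 1) := fun x hx y hy h =>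
    (pow_left_inj₀ hx.1.le hy.1.le two_ne_zero).1 h
  have h1 := integrableOn_betaIntegrand ha hb
  have h2 := integral_betaIntegrand ha hb
  rw [← image_sq_Ioo, integrableOn_image_iff_integrableOn_abs_deriv_smul measurableSet_Ioo hd hinj]
    at h1
  rw [← image_sq_Ioo, integral_image_eq_integral_abs_deriv_smul measurableSet_Ioo hd hinj] at h2
  constructor
  · have := (h1.congr_fun (fun u hu => betaIntegrand_sq a b hu) measurableSet_Ioo).const_mul
      (1 / 2 : ℝ)
    refine IntegrableOn.congr_fun this (fun u _ => ?_) measurableSet_Ioo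
    ring
  · rw [← h2, ← integral_const_mul]
    exact setIntegral_congr_fun measurableSet_Ioo fun u hu => (betaIntegrand_sq a b hu).symm

theorem measurable_piDensity (γ : ℝ) : Measurable (piDensity γ) := by
  unfold piDensity
  fun_prop

theorem piAbs_restrict {γ : ℝ} (hγ : γ ≠ -1 / 2) : (piAbs γ).restrict (Set.Ioc 0 1) =
    (volume.restrict (Set.Ioo 0 1)).withDensity fun u => ENNReal.ofReal |piDensity γ u| := by
  rw [piAbs, if_neg hγ, restrict_withDensity measurableSet_Ioc, Measure.restrict_restrict
    measurableSet_Ioc]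
  congr 2
  ext u
  simp only [Set.mem_inter_iff, Set.mem_Ioc, Set.mem_Ioo]
  constructor
  · rintro ⟨⟨a, b⟩, c, d⟩; exact ⟨a, d⟩
  · rintro ⟨a, b⟩; exact ⟨⟨a, b.le⟩, by linarith, b⟩

theorem piAbs_restrict_half : (piAbs (-1 / 2)).restrict (Set.Ioc 0 1) =
    ENNReal.ofReal (1 / 2) • Measure.dirac 1 := by
  rw [piAbs, if_pos rfl, Measure.restrict_smul, Measure.restrict_add,
    restrict_dirac' measurableSet_Ioc, restrict_dirac' measurableSet_Ioc, if_neg (by norm_num),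
    if_pos (by norm_num), zero_add]

/-- The sign of the density is that of Γ(γ+1/2), which Γ(x+1) = xΓ(x) makes negative for -1 < γ <
-1/2. -/
theorem piSign_mul_abs_piDensity {γ : ℝ} (hγ : -1 < γ) {u : ℝ} (hu : u ∈ Set.Ioo (0 : ℝ) 1) :
    piSign γ * |piDensity γ u| = piDensity γ u := by
  have h1 : 0 < (1 - u ^ 2) ^ (γ - 1 / 2) := Real.rpow_pos_of_pos (by nlinarith [hu.1, hu.2]) _
  have h2 : 0 < Real.Gamma (γ + 1) := Real.Gamma_pos_of_pos (by linarith)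
  have h3 : 0 < Real.sqrt Real.pi := Real.sqrt_pos.2 Real.pi_pos
  rw [piSign]
  split_ifs with h
  · have h4 : Real.Gamma (γ + 1 / 2) < 0 := by
      have h5 := Real.Gamma_add_one (show γ + 1 / 2 ≠ 0 by linarith)
      have h6 : 0 < Real.Gamma (γ + 1 / 2 + 1) := Real.Gamma_pos_of_pos (by linarith)
      rw [h5] at h6
      exact neg_of_mul_pos_right h6 (by linarith)
    have : piDensity γ u ≤ 0 := by
      rw [piDensity]
      refine mul_nonpos_of_nonpos_of_nonneg ?_ h1.le
      exact div_nonpos_of_nonneg_of_nonpos h2.le (mul_nonpos_of_nonneg_of_nonpos h3.le h4.le)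
    rw [abs_of_nonpos this]
    ring
  · have h4 : 0 ≤ Real.Gamma (γ + 1 / 2) := Real.Gamma_nonneg_of_nonneg (by linarith)
    have : 0 ≤ piDensity γ u := by
      rw [piDensity]
      positivity
    rw [abs_of_nonneg this]
    ring

theorem integrable_piAbs_iff {γ : ℝ} (h : γ ≠ -1 / 2) (f : ℝ → ℝ) :
    Integrable f ((piAbs γ).restrict (Set.Ioc 0 1)) ↔
      IntegrableOn (fun u => |piDensity γ u| * f u) (Set.Ioo 0 1) := by
  rw [piAbs_restrict h, integrable_withDensity_iff_integrable_smul'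
    (measurable_piDensity γ).abs.ennreal_ofReal
    (Filter.Eventually.of_forall fun _ => ENNReal.ofReal_lt_top)]
  simp [IntegrableOn]

theorem piIntegral_eq {γ : ℝ} (hγ : -1 < γ) (h : γ ≠ -1 / 2) (f : ℝ → ℝ) :
    piIntegral γ f = ∫ u in Set.Ioo (0 : ℝ) 1, piDensity γ u * f u := by
  rw [piIntegral, piAbs_restrict h, integral_withDensity_eq_integral_toReal_smul
    (measurable_piDensity γ).abs.ennreal_ofReal
    (Filter.Eventually.of_forall fun _ => ENNReal.ofReal_lt_top), ← integral_const_mul]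
  refine setIntegral_congr_fun measurableSet_Ioo fun u hu => ?_
  rw [ENNReal.toReal_ofReal (abs_nonneg _), smul_eq_mul, ← mul_assoc,
    piSign_mul_abs_piDensity hγ hu]

/-- Since 1-u ≤ 1-u² on (0,1), the extra factor raises the exponent from γ - 1/2 to γ + 1/2 > -1/2,
and a convergent Beta integral dominates. -/
theorem integrable_one_sub_piAbs {γ : ℝ} (hγ : -1 < γ) :
    Integrable (fun u => 1 - u) ((piAbs γ).restrict (Set.Ioc 0 1)) := by
  by_cases h : γ = -1 / 2
  · rw [h, piAbs_restrict_half]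
    exact (integrable_dirac (by simp [enorm])).smul_measure ENNReal.ofReal_ne_top
  rw [integrable_piAbs_iff h]
  have h1 := (betaIntegrand_sq_integral (a := 1 / 2) (b := γ + 3 / 2) (by norm_num)
    (by linarith)).1.const_mul (|Real.Gamma (γ + 1) / (Real.sqrt Real.pi * Real.Gamma (γ + 1 / 2))|)
  refine Integrable.mono' h1 ?_ ?_
  · exact ((measurable_piDensity γ).abs.mul (by fun_prop)).aestronglyMeasurable
  · refine (ae_restrict_iff' measurableSet_Ioo).2 (Filter.Eventually.of_forall fun u hu => ?_)
    have h2 : 0 < 1 - u ^ 2 := by nlinarith [hu.1, hu.2]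
    have h3 : 0 ≤ 1 - u := by linarith [hu.2]
    have h4 : 1 - u ≤ 1 - u ^ 2 := by nlinarith [hu.1, hu.2]
    rw [piDensity, Real.norm_eq_abs, abs_mul, abs_abs, abs_of_nonneg h3, abs_mul,
      abs_of_pos (Real.rpow_pos_of_pos h2 _), mul_assoc]
    refine mul_le_mul_of_nonneg_left ?_ (abs_nonneg _)
    rw [show 2 * (1 / 2 : ℝ) - 1 = 0 by norm_num, Real.rpow_zero, one_mul,
      show γ + 3 / 2 - 1 = γ - 1 / 2 + 1 by ring, Real.rpow_add_one h2.ne']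
    exact mul_le_mul_of_nonneg_left h4 (Real.rpow_pos_of_pos h2 _).le

theorem abs_pow_sub_one_le {u : ℝ} (hu : u ∈ Set.Icc (0 : ℝ) 1) (k : ℕ) :
    |u ^ k - 1| ≤ k * (1 - u) := by
  rw [abs_sub_comm, abs_of_nonneg (by linarith [pow_le_one₀ hu.1 hu.2 (n := k)])]
  have := one_add_mul_le_pow (a := u - 1) (by linarith [hu.1]) k
  rw [show 1 + (u - 1) = u by ring] at this
  linarith

theorem integrable_pow_sub_one_piAbs {γ : ℝ} (hγ : -1 < γ) (k : ℕ) :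
    Integrable (fun u => u ^ k - 1) ((piAbs γ).restrict (Set.Ioc 0 1)) := by
  refine Integrable.mono' ((integrable_one_sub_piAbs hγ).const_mul (k : ℝ))
    (by fun_prop) ?_
  exact (ae_restrict_iff' measurableSet_Ioc).2 (Filter.Eventually.of_forall fun u hu =>
    abs_pow_sub_one_le ⟨hu.1.le, hu.2⟩ k)

/-- The regularised even moments of `dΠ_γ`. -/
theorem two_mul_piIntegral_pow_sub_one {γ : ℝ} (hγ : -1 < γ) (i : ℕ) :
    2 * piIntegral γ (fun u => u ^ (2 * i) - 1) + 1 = poch (1 / 2) i / poch (γ + 1) i := by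
  by_cases h : γ = -1 / 2
  · have p := (poch_pos (show (0 : ℝ) < 1 / 2 by norm_num) i).ne'
    rw [h, piIntegral, piAbs_restrict_half, integral_smul_measure, integral_dirac,
      show (-1 / 2 : ℝ) + 1 = 1 / 2 by norm_num, div_self p]
    simp
  have hγ1 : 0 < γ + 1 := by linarith
  induction i with
  | zero => simp [poch_zero, piIntegral]
  | succ i ih =>
    have hI : ∀ k, IntegrableOn (fun u => piDensity γ u * (u ^ k - 1)) (Set.Ioo 0 1) := by
      intro k
      have h1 := (integrable_piAbs_iff h _).1 (integrable_pow_sub_one_piAbs hγ k)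
      refine IntegrableOn.congr_fun (h1.const_mul (piSign γ)) (fun u hu => ?_) measurableSet_Ioo
      rw [← mul_assoc, piSign_mul_abs_piDensity hγ hu]
    -- Consecutive moments differ by the integral of -u^{2i}(1-u²), a convergent Beta integral for
    -- every γ > -1; no analytic continuation in γ is needed.
    have hdiff : piIntegral γ (fun u => u ^ (2 * (i + 1)) - 1)
        - piIntegral γ (fun u => u ^ (2 * i) - 1) =
        -(Real.Gamma (γ + 1) / (Real.sqrt Real.pi * Real.Gamma (γ + 1 / 2))) *
          ∫ u in Set.Ioo (0 : ℝ) 1, u ^ (2 * (i + 1 / 2 : ℝ) - 1) *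
            (1 - u ^ 2) ^ (γ + 3 / 2 - 1) := by
      rw [piIntegral_eq hγ h, piIntegral_eq hγ h, ← integral_sub (hI _) (hI _),
        ← integral_const_mul]
      refine setIntegral_congr_fun measurableSet_Ioo fun u hu => ?_
      have h2 : 0 < 1 - u ^ 2 := by nlinarith [hu.1, hu.2]
      rw [piDensity, show 2 * ((i : ℝ) + 1 / 2) - 1 = ((2 * i : ℕ) : ℝ) by push_cast; ring,
        Real.rpow_natCast, show γ + 3 / 2 - 1 = γ - 1 / 2 + 1 by ring,
        Real.rpow_add_one h2.ne']
      ring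
    have hB := (betaIntegrand_sq_integral (a := i + 1 / 2) (b := γ + 3 / 2) (by positivity)
      (by linarith)).2
    have g1 : Real.Gamma ((i : ℝ) + 1 / 2) = poch (1 / 2) i * Real.sqrt Real.pi := by
      rw [add_comm, Gamma_add_nat (by norm_num), Real.Gamma_one_half_eq]
    have g2 : Real.Gamma (γ + 3 / 2) = (γ + 1 / 2) * Real.Gamma (γ + 1 / 2) := by
      rw [← Real.Gamma_add_one (fun h0 => h (by linarith))]
      congr 1; ring
    have g3 : Real.Gamma ((i : ℝ) + 1 / 2 + (γ + 3 / 2))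
        = poch (γ + 1) (i + 1) * Real.Gamma (γ + 1) := by
      rw [← Gamma_add_nat hγ1]
      congr 1; push_cast; ring
    have g4 : Real.Gamma (γ + 1 / 2) ≠ 0 := by
      intro h0
      have := Real.Gamma_pos_of_pos (show 0 < γ + 3 / 2 by linarith)
      rw [g2, h0] at this
      simp at this
    have g5 := (Real.Gamma_pos_of_pos hγ1).ne'
    have g6 : Real.sqrt Real.pi ≠ 0 := (Real.sqrt_pos.2 Real.pi_pos).ne'
    have g7 := (poch_pos hγ1 i).ne'
    have g8 : γ + 1 + (i : ℝ) ≠ 0 := by positivity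
    rw [g1, g2, g3, poch_succ] at hB
    have e : 2 * piIntegral γ (fun u => u ^ (2 * (i + 1)) - 1) + 1 =
        (2 * piIntegral γ (fun u => u ^ (2 * i) - 1) + 1) +
        2 * (piIntegral γ (fun u => u ^ (2 * (i + 1)) - 1)
          - piIntegral γ (fun u => u ^ (2 * i) - 1)) := by ring
    rw [e, ih, hdiff, mul_left_comm, hB, poch_succ, poch_succ]
    generalize Real.Gamma (γ + 1 / 2) = G at g4 ⊢
    field_simp
    ring

end PiMeasure

/-! ### The regularised integral as a functional, and its values on Gegenbauer polynomials. -/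

section Regularised

/-- Dominated convergence with majorants of product form: a summable constant times one fixed
integrable function. -/
theorem integrable_and_hasSum_integral {X ι : Type*} [MeasurableSpace X] [Countable ι]
    {μ : Measure X} {F : ι → X → ℝ} {G b : X → ℝ} {M : ι → ℝ} (hb : Integrable b μ)
    (hM : Summable M) (hF : ∀ i, AEStronglyMeasurable (F i) μ)
    (hbound : ∀ᵐ x ∂μ, ∀ i, |F i x| ≤ M i * b x) (hG : ∀ᵐ x ∂μ, HasSum (fun i => F i x) (G x)) :
    Integrable G μ ∧ HasSum (fun i => ∫ x, F i x ∂μ) (∫ x, G x ∂μ) := by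
  have hGm : AEStronglyMeasurable G μ := by
    refine aestronglyMeasurable_of_tendsto_ae (Filter.atTop : Filter (Finset ι))
      (f := fun s x => ∑ i ∈ s, F i x) (fun s => ?_) hG
    exact Finset.aestronglyMeasurable_fun_sum s fun i _ => hF i
  constructor
  · refine Integrable.mono' (hb.const_mul (∑' i, M i)) hGm ?_
    filter_upwards [hbound, hG] with x h1 h2
    rw [← tsum_mul_right, ← h2.tsum_eq]
    exact tsum_of_norm_bounded (hM.mul_right (b x)).hasSum h1
  · refine hasSum_integral_of_dominated_convergence (fun i x => M i * b x) hF
      (fun i => hbound.mono fun x h => h i) (Filter.Eventually.of_forall fun x => hM.mul_right _)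
      ?_ hG
    simp only [tsum_mul_right]
    exact hb.const_mul _

/-- `F` is integrable in the regularised sense against `dΠ_α ⊗ dΠ_β`. -/
def RegIntegrable (α β : ℝ) (F : ℝ → ℝ → ℝ) : Prop :=
  PiIntegrable₂ α β (secondDiff F) ∧ PiIntegrable α (fun u => F u 1 - F 1 1) ∧
    PiIntegrable β (fun v => F 1 v - F 1 1)

/-- The regularised integral of `F` against `dΠ_α ⊗ dΠ_β`. -/
def regIntegral (α β : ℝ) (F : ℝ → ℝ → ℝ) : ℝ :=
  4 * piIntegral₂ α β (secondDiff F) + 2 * piIntegral α (fun u => F u 1 - F 1 1)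
    + 2 * piIntegral β (fun v => F 1 v - F 1 1) + F 1 1

/-- The differences of `F` vanish at `u = 1`, `v = 1` at a linear rate with constant `M`. -/
def DiffBound (F : ℝ → ℝ → ℝ) (M : ℝ) : Prop :=
  ∀ u ∈ Set.Icc (0 : ℝ) 1, ∀ v ∈ Set.Icc (0 : ℝ) 1,
    |secondDiff F u v| ≤ M * ((1 - u) * (1 - v)) ∧ |F u 1 - F 1 1| ≤ M * (1 - u) ∧
    |F 1 v - F 1 1| ≤ M * (1 - v)

theorem regIntegrable_and_hasSum {ι : Type*} [Countable ι] {α β : ℝ} (hα : -1 < α) (hβ : -1 < β)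
    {F : ι → ℝ → ℝ → ℝ} {G : ℝ → ℝ → ℝ} {M : ι → ℝ}
    (hc : ∀ i, Continuous fun p : ℝ × ℝ => F i p.1 p.2) (hF : ∀ i, DiffBound (F i) (M i))
    (hM : Summable M) (hG : ∀ u ∈ Set.Icc (0 : ℝ) 1, ∀ v ∈ Set.Icc (0 : ℝ) 1,
      HasSum (fun i => F i u v) (G u v)) :
    RegIntegrable α β G ∧ HasSum (fun i => regIntegral α β (F i)) (regIntegral α β G) := by
  have one : (1 : ℝ) ∈ Set.Icc (0 : ℝ) 1 := by norm_num
  have cu : ∀ i, Continuous fun u => F i u 1 := fun i =>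
    (hc i).comp (continuous_id.prodMk continuous_const)
  have cv : ∀ i, Continuous fun v => F i 1 v := fun i =>
    (hc i).comp (continuous_const.prodMk continuous_id)
  have ae1 : ∀ γ, ∀ᵐ u ∂(piAbs γ).restrict (Set.Ioc 0 1), u ∈ Set.Icc (0 : ℝ) 1 := fun γ =>
    (ae_restrict_iff' measurableSet_Ioc).2 (Filter.Eventually.of_forall fun u hu =>
      ⟨hu.1.le, hu.2⟩)
  have ae2 : ∀ᵐ p ∂((piAbs α).prod (piAbs β)).restrict (Set.Ioc 0 1 ×ˢ Set.Ioc 0 1),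
      p.1 ∈ Set.Icc (0 : ℝ) 1 ∧ p.2 ∈ Set.Icc (0 : ℝ) 1 :=
    (ae_restrict_iff' (measurableSet_Ioc.prod measurableSet_Ioc)).2
      (Filter.Eventually.of_forall fun p hp => ⟨⟨hp.1.1.le, hp.1.2⟩, ⟨hp.2.1.le, hp.2.2⟩⟩)
  have b2 : Integrable (fun p : ℝ × ℝ => (1 - p.1) * (1 - p.2))
      (((piAbs α).prod (piAbs β)).restrict (Set.Ioc 0 1 ×ˢ Set.Ioc 0 1)) := by
    rw [← Measure.prod_restrict]
    exact (integrable_one_sub_piAbs hα).mul_prod (integrable_one_sub_piAbs hβ)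
  obtain ⟨i2, s2⟩ := integrable_and_hasSum_integral
    (F := fun i (p : ℝ × ℝ) => secondDiff (F i) p.1 p.2)
    (G := fun p : ℝ × ℝ => secondDiff G p.1 p.2) b2 hM
    (fun i => by
      refine Continuous.aestronglyMeasurable ?_
      exact (((hc i).sub ((cu i).comp continuous_fst)).sub
        ((cv i).comp continuous_snd)).add continuous_const)
    (ae2.mono fun p hp i => (hF i p.1 hp.1 p.2 hp.2).1)
    (ae2.mono fun p hp => (((hG _ hp.1 _ hp.2).sub (hG _ hp.1 _ one)).sub
      (hG _ one _ hp.2)).add (hG _ one _ one))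
  obtain ⟨iu, su⟩ := integrable_and_hasSum_integral
    (F := fun i (u : ℝ) => F i u 1 - F i 1 1)
    (G := fun u => G u 1 - G 1 1) (integrable_one_sub_piAbs hα) hM
    (fun i => ((cu i).sub continuous_const).aestronglyMeasurable)
    ((ae1 α).mono fun u hu i => (hF i u hu 1 one).2.1)
    ((ae1 α).mono fun u hu => (hG _ hu _ one).sub (hG _ one _ one))
  obtain ⟨iv, sv⟩ := integrable_and_hasSum_integral
    (F := fun i (v : ℝ) => F i 1 v - F i 1 1)
    (G := fun v => G 1 v - G 1 1) (integrable_one_sub_piAbs hβ) hM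
    (fun i => ((cv i).sub continuous_const).aestronglyMeasurable)
    ((ae1 β).mono fun v hv i => (hF i 1 one v hv).2.2)
    ((ae1 β).mono fun v hv => (hG _ one _ hv).sub (hG _ one _ one))
  exact ⟨⟨i2, iu, iv⟩, ((((s2.mul_left _).mul_left 4).add ((su.mul_left _).mul_left 2)).add
    ((sv.mul_left _).mul_left 2)).add (hG _ one _ one)⟩

theorem regIntegral_const_mul (α β c : ℝ) (F : ℝ → ℝ → ℝ) :
    regIntegral α β (fun u v => c * F u v) = c * regIntegral α β F := by
  have e2 : secondDiff (fun u v => c * F u v) = fun u v => c * secondDiff F u v := by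
    ext u v; simp only [secondDiff]; ring
  simp only [regIntegral, e2, ← mul_sub, piIntegral₂, piIntegral, integral_const_mul]
  ring

/-- The regularised product moment. -/
def regMoment (γ : ℝ) (i : ℕ) : ℝ := poch (1 / 2) i / poch (γ + 1) i

theorem regIntegral_monomial {α β : ℝ} (hα : -1 < α) (hβ : -1 < β) (i j : ℕ) :
    regIntegral α β (fun u v => u ^ (2 * i) * v ^ (2 * j)) = regMoment α i * regMoment β j := by
  have hA := two_mul_piIntegral_pow_sub_one hα i
  have hB := two_mul_piIntegral_pow_sub_one hβ j
  have e2 : secondDiff (fun u v => u ^ (2 * i) * v ^ (2 * j)) =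
      fun u v => (u ^ (2 * i) - 1) * (v ^ (2 * j) - 1) := by
    ext u v; simp only [secondDiff]; ring
  rw [regMoment, regMoment, ← hA, ← hB, regIntegral, e2]
  simp only [one_pow, mul_one, one_mul]
  rw [piIntegral₂, setIntegral_prod_mul (fun u : ℝ => u ^ (2 * i) - 1)
    (fun v : ℝ => v ^ (2 * j) - 1), piIntegral, piIntegral]
  ring

/-- The three differences need the constants ij, i and j by Bernoulli's inequality; their sum covers
all of them. -/
theorem diffBound_monomial (c : ℝ) (i j : ℕ) : DiffBound (fun u v => c * (u ^ i * v ^ j))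
    (|c| * (i * j + i + j)) := by
  intro u hu v hv
  have h1 := abs_pow_sub_one_le hu i
  have h2 := abs_pow_sub_one_le hv j
  have hi : (0 : ℝ) ≤ i := i.cast_nonneg
  have hj : (0 : ℝ) ≤ j := j.cast_nonneg
  have hu' : 0 ≤ 1 - u := by linarith [hu.2]
  have hv' : 0 ≤ 1 - v := by linarith [hv.2]
  simp only [secondDiff, one_pow, mul_one, one_mul]
  refine ⟨?_, ?_, ?_⟩
  · rw [show c * (u ^ i * v ^ j) - c * u ^ i - c * v ^ j + c
      = c * ((u ^ i - 1) * (v ^ j - 1)) by ring, abs_mul, abs_mul, mul_assoc]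
    refine mul_le_mul_of_nonneg_left ?_ (abs_nonneg _)
    calc |u ^ i - 1| * |v ^ j - 1| ≤ (i * (1 - u)) * (j * (1 - v)) :=
          mul_le_mul h1 h2 (abs_nonneg _) (by positivity)
      _ = (i * j) * ((1 - u) * (1 - v)) := by ring
      _ ≤ _ := mul_le_mul_of_nonneg_right (by linarith) (by positivity)
  · rw [← mul_sub_one, abs_mul, mul_assoc]
    refine mul_le_mul_of_nonneg_left (h1.trans ?_) (abs_nonneg _)
    exact mul_le_mul_of_nonneg_right (by nlinarith) hu'
  · rw [← mul_sub_one, abs_mul, mul_assoc]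
    refine mul_le_mul_of_nonneg_left (h2.trans ?_) (abs_nonneg _)
    exact mul_le_mul_of_nonneg_right (by nlinarith) hv'

/-- Finite linearity is the series theorem over a finite index type, which supplies the
integrability as well. -/
theorem regIntegral_sum {α β : ℝ} (hα : -1 < α) (hβ : -1 < β) {ι : Type*} (s : Finset ι)
    (c : ι → ℝ) (p q : ι → ℕ) :
    regIntegral α β (fun u v => ∑ k ∈ s, c k * (u ^ (2 * p k) * v ^ (2 * q k)))
      = ∑ k ∈ s, c k * (regMoment α (p k) * regMoment β (q k)) := by
  have h := (regIntegrable_and_hasSum hα hβ (ι := s)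
    (F := fun k u v => c k * (u ^ (2 * p k) * v ^ (2 * q k)))
    (G := fun u v => ∑ k ∈ s, c k * (u ^ (2 * p k) * v ^ (2 * q k)))
    (fun k => by fun_prop) (fun k => diffBound_monomial _ _ _) Summable.of_finite
    (fun u _ v _ => s.hasSum _)).2
  simp only [regIntegral_const_mul, regIntegral_monomial hα hβ] at h
  exact h.unique (s.hasSum fun k => c k * (regMoment α (p k) * regMoment β (q k)))

theorem sum_range_two_mul_add_one_of_odd_eq_zero {g : ℕ → ℝ} (hg : ∀ k, Odd k → g k = 0) (m : ℕ) :
    ∑ k ∈ range (2 * m + 1), g k = ∑ i ∈ range (m + 1), g (2 * i) := by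
  induction m with
  | zero => simp
  | succ m ih =>
    rw [show 2 * (m + 1) + 1 = 2 * m + 1 + 1 + 1 by ring, sum_range_succ, sum_range_succ, ih,
      hg (2 * m + 1) ⟨m, rfl⟩, add_zero, sum_range_succ _ (m + 1)]
    rfl

theorem add_pow_add_sub_pow (x y : ℝ) (m : ℕ) : ((x + y) ^ (2 * m) + (x - y) ^ (2 * m)) / 2 =
    ∑ ij ∈ antidiagonal m, ((2 * m).choose (2 * ij.2) : ℝ) * (x ^ (2 * ij.1) * y ^ (2 * ij.2)) := by
  rw [← Finset.Nat.sum_antidiagonal_swap, Finset.Nat.sum_antidiagonal_eq_sum_range_succ_mk]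
  have h := sum_range_two_mul_add_one_of_odd_eq_zero
    (g := fun k => (y ^ k * x ^ (2 * m - k) * ((2 * m).choose k : ℝ)
      + (-y) ^ k * x ^ (2 * m - k) * ((2 * m).choose k : ℝ)) / 2)
    (fun k hk => by rw [hk.neg_pow]; ring) m
  rw [sub_eq_add_neg, add_comm x y, add_comm x (-y), add_pow, add_pow, ← sum_add_distrib, sum_div,
    h]
  refine sum_congr rfl fun i hi => ?_
  rw [(even_two_mul i).neg_pow]
  simp only [Prod.swap_prod_mk, Nat.mul_sub]
  ring

/-- `∑_{i+j=m} a^{2i} b^{2j} / (i! (α+1)_i j! (β+1)_j)`. -/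
def appellH (α β a b : ℝ) (m : ℕ) : ℝ :=
  ∑ ij ∈ antidiagonal m,
    jcoef (α + 1) ij.1 * (a ^ 2) ^ ij.1 * (jcoef (β + 1) ij.2 * (b ^ 2) ^ ij.2)

theorem factorial_two_mul (i : ℕ) :
    ((2 * i).factorial : ℝ) = 4 ^ i * (i.factorial : ℝ) * poch (1 / 2) i := by
  induction i with
  | zero => simp [poch_zero]
  | succ i ih =>
    rw [show 2 * (i + 1) = 2 * i + 1 + 1 by ring, Nat.factorial_succ, Nat.factorial_succ,
      Nat.factorial_succ, poch_succ]
    push_cast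
    rw [ih]
    ring

/-- The regularised integrals of the Gegenbauer polynomials. -/
theorem regIntegral_gegenEven {α β : ℝ} (hα : -1 < α) (hβ : -1 < β) (s a b : ℝ) (n : ℕ) :
    regIntegral α β (evenPart (gegenEven s n) a b) =
      ∑ m ∈ range (n + 1), (-1) ^ (n + m) * poch s (n + m) * invFactSub n m *
        appellH α β a b m := by
  have e : evenPart (gegenEven s n) a b = fun u v =>
      ∑ k ∈ (range (n + 1)).sigma (fun m => antidiagonal m),
        (evenCoef s n k.1 * 4 ^ k.1 * ((2 * k.1).choose (2 * k.2.2) : ℝ) *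
          (a ^ (2 * k.2.1) * b ^ (2 * k.2.2))) * (u ^ (2 * k.2.1) * v ^ (2 * k.2.2)) := by
    ext u v
    rw [sum_sigma, evenPart, gegenEven, gegenEven, ← sum_add_distrib, sum_div]
    refine sum_congr rfl fun m _ => ?_
    have h := add_pow_add_sub_pow (u * a) (v * b) m
    have h2 : (evenCoef s n m * (2 * (u * a + v * b)) ^ (2 * m)
        + evenCoef s n m * (2 * (u * a - v * b)) ^ (2 * m)) / 2
        = evenCoef s n m * 4 ^ m *
          (((u * a + v * b) ^ (2 * m) + (u * a - v * b) ^ (2 * m)) / 2) := by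
      rw [mul_pow, mul_pow, pow_mul 2 2 m]
      norm_num
      ring
    rw [h2, h, mul_sum]
    refine sum_congr rfl fun ij _ => ?_
    rw [mul_pow, mul_pow]
    ring
  rw [e, regIntegral_sum hα hβ, sum_sigma]
  refine sum_congr rfl fun m _ => ?_
  rw [appellH, mul_sum]
  refine sum_congr rfl fun ij hij => ?_
  have hm := mem_antidiagonal.1 hij
  have h1 := (poch_pos (show 0 < α + 1 by linarith) ij.1).ne'
  have h2 := (poch_pos (show 0 < β + 1 by linarith) ij.2).ne'
  have h3 := (poch_pos (show (0 : ℝ) < 1 / 2 by norm_num) ij.1).ne'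
  have h4 := (poch_pos (show (0 : ℝ) < 1 / 2 by norm_num) ij.2).ne'
  have h5 : ((2 * m).choose (2 * ij.2) : ℝ)
      = ((2 * m).factorial : ℝ) / (((2 * ij.1).factorial : ℝ) * ((2 * ij.2).factorial : ℝ)) := by
    rw [Nat.cast_choose ℝ (by omega), show 2 * m - 2 * ij.2 = 2 * ij.1 by omega, mul_comm
      ((2 * ij.2).factorial : ℝ)]
  have h6 : ((2 * m).factorial : ℝ) ≠ 0 := by exact_mod_cast (2 * m).factorial_ne_zero
  simp only
  -- Writing (2i)! = 4^i i! (1/2)_i cancels the numerators (1/2)_i and (1/2)_j of the moments and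
  -- the power 4^m; the coefficients of `appellH` remain.
  rw [h5, evenCoef, factorial_two_mul ij.1, factorial_two_mul ij.2, ← pow_mul, ← pow_mul, jcoef,
    jcoef, regMoment, regMoment, ← hm, pow_add 4]
  rw [hm]
  field_simp

end Regularised

/-! ### Matching the Jacobi series with the regularised Gegenbauer series. -/

section Kernel

theorem hasSum_congr_of_eq {f g : ℕ → ℝ} {a b : ℝ} (h : HasSum f a) (hf : ∀ n, g n = f n)
    (hab : b = a) : HasSum g b := by
  rwa [hab, funext hf]

/-- The regularised integral of the Gegenbauer polynomial `C_{2n}^{α+β+2}(u a + v b)`. -/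
def gegenReg (α β a b : ℝ) (n : ℕ) : ℝ :=
  ∑ m ∈ range (n + 1), (-1) ^ (n + m) * poch (α + β + 2) (n + m) * invFactSub n m *
    appellH α β a b m

/-- The factor of the Appell function in the product of two normalised Jacobi polynomials. -/
def jacobiWeight (α β : ℝ) (n : ℕ) : ℝ :=
  (-1) ^ n * poch (α + β + 2) (2 * n) / ((n.factorial : ℝ) * poch (n + (α + β + 1)) n)

theorem jacobiWeight_mul_appellF_zero (α β a b : ℝ) :
    jacobiWeight α β 0 * appellF 0 (α + β + 1) (α + 1) (β + 1) (a ^ 2) (b ^ 2)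
      = gegenReg α β a b 0 := by
  simp [jacobiWeight, appellF, gegenReg, jw_zero, poch_zero, invFactSub, appellH]

/-- After removal of the common factor (-1)^{n+1+m} (s)_{n+m} / (n+1-m)!, the claim in degree m is
s+2n+1 = (s+n+m) + (n+1-m). -/
theorem jacobiWeight_mul_appellF_succ {α β : ℝ} (hα : -1 < α) (hβ : -1 < β) (a b : ℝ) (n : ℕ) :
    jacobiWeight α β (n + 1) * appellF (n + 1) (α + β + 1) (α + 1) (β + 1) (a ^ 2) (b ^ 2)
      = gegenReg α β a b (n + 1) - gegenReg α β a b n := by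
  have h0 : gegenReg α β a b n = ∑ m ∈ range (n + 1 + 1),
      (-1) ^ (n + m) * poch (α + β + 2) (n + m) * invFactSub n m * appellH α β a b m := by
    rw [sum_range_succ _ (n + 1), invFactSub_eq_zero (Nat.lt_succ_self n)]
    simp [gegenReg]
  rw [h0, gegenReg, appellF, mul_sum, ← sum_sub_distrib]
  refine sum_congr rfl fun m _ => ?_
  change jacobiWeight α β (n + 1) * (jw (n + 1) (α + β + 1) m * appellH α β a b m) = _
  rw [← mul_assoc, ← sub_mul]
  congr 1
  set s := α + β + 2 with hs
  have hs0 : 0 < s := by linarith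
  have h1 : ((n + 1 : ℕ) : ℝ) + (α + β + 1) = s + n := by rw [hs]; push_cast; ring
  have h2 : poch s (2 * (n + 1)) = poch s n * poch (s + n) (n + 1) * (s + 2 * n + 1) := by
    rw [show 2 * (n + 1) = n + (n + 1) + 1 by ring, poch_succ, poch_add]
    push_cast
    ring
  have h3 : ((n + 1).choose m : ℝ) * (m.factorial : ℝ)
      = ((n + 1).factorial : ℝ) * invFactSub (n + 1) m := by
    rw [invFactSub]
    have : ((n + 1).factorial : ℝ) ≠ 0 := by exact_mod_cast (n + 1).factorial_ne_zero
    field_simp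
  have h4 : poch (s + n) (n + 1) ≠ 0 := (poch_pos (by positivity) _).ne'
  have h5 : ((n + 1).factorial : ℝ) ≠ 0 := by exact_mod_cast (n + 1).factorial_ne_zero
  rw [jacobiWeight, jw, poch_neg_nat, h1, ← hs, h2, mul_assoc ((-1) ^ m), h3,
    show n + 1 + m = n + m + 1 by ring, poch_succ s (n + m), poch_add s n m, ← invFactSub_succ n m,
    pow_succ _ (n + m), pow_succ _ n, pow_add]
  push_cast
  field_simp
  ring

/-- Summation by parts: the series of differences is the original series minus r times itself. -/
theorem hasSum_jacobiWeight_mul_appellF {α β : ℝ} (hα : -1 < α) (hβ : -1 < β) {a b r Q : ℝ}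
    (h : HasSum (fun n => r ^ n * gegenReg α β a b n) Q) :
    HasSum (fun n => r ^ n * (jacobiWeight α β n *
      appellF n (α + β + 1) (α + 1) (β + 1) (a ^ 2) (b ^ 2))) ((1 - r) * Q) := by
  rw [← hasSum_nat_add_iff' 1] at h ⊢
  have h' := (hasSum_nat_add_iff' 1).1 h
  refine hasSum_congr_of_eq (h.sub (h'.mul_left r)) (fun n => ?_) ?_
  · rw [jacobiWeight_mul_appellF_succ hα hβ, pow_succ]
    ring
  · simp only [sum_range_one, jacobiWeight_mul_appellF_zero, pow_zero, one_mul]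
    ring

theorem DiffBound.const_mul {F : ℝ → ℝ → ℝ} {M k : ℝ} (h : DiffBound F M) (hk : 0 ≤ k) :
    DiffBound (fun u v => k * F u v) (k * M) := by
  intro u hu v hv
  obtain ⟨h1, h2, h3⟩ := h u hu v hv
  simp only [secondDiff, ← mul_sub, ← mul_add, abs_mul, abs_of_nonneg hk, mul_assoc] at h1 ⊢
  exact ⟨mul_le_mul_of_nonneg_left h1 hk, mul_le_mul_of_nonneg_left h2 hk,
    mul_le_mul_of_nonneg_left h3 hk⟩

theorem Psi_eq (α β t θ φ u v : ℝ) : Psi α β t θ φ u v = cConst α β * Real.sinh (t / 2) /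
    (Real.cosh (t / 2) - (u * (Real.sin (θ / 2) * Real.sin (φ / 2))
      + v * (Real.cos (θ / 2) * Real.cos (φ / 2)))) ^ (α + β + 2) := by
  rw [Psi, qFun]
  congr 2
  ring

/-- `1 - 2 w ρ + ρ² = 2 ρ (cosh (t/2) - w)` for `ρ = e^{-t/2}`, raised to a power. -/
theorem rpow_generating {t w : ℝ} (ht : 0 < t) (hw : |w| ≤ 1) (s : ℝ) :
    (1 - 2 * w * Real.exp (-(t / 2)) + Real.exp (-(t / 2)) ^ 2) ^ (-s)
      = (2 * Real.exp (-(t / 2))) ^ (-s) / (Real.cosh (t / 2) - w) ^ s := by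
  have hp := Real.exp_pos (-(t / 2))
  have hC : 1 < Real.cosh (t / 2) := Real.one_lt_cosh.2 (by positivity)
  have hCw : 0 < Real.cosh (t / 2) - w := by linarith [(abs_le.1 hw).2]
  have e : 1 - 2 * w * Real.exp (-(t / 2)) + Real.exp (-(t / 2)) ^ 2
      = 2 * Real.exp (-(t / 2)) * (Real.cosh (t / 2) - w) := by
    have : Real.exp (t / 2) * Real.exp (-(t / 2)) = 1 := by rw [← Real.exp_add]; simp
    rw [Real.cosh_eq]
    linear_combination -this
  rw [e, Real.mul_rpow (by positivity) hCw.le, Real.rpow_neg hCw.le, ← div_eq_mul_inv]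

/-- The four sign choices give the arguments ±(ua+vb) and ±(ua-vb). Each pair of opposite arguments
is one even Gegenbauer generating function at p = e^{-t/2}. -/
theorem hasSum_PsiE {α β t θ φ : ℝ} (ht : 0 < t) {u v : ℝ}
    (hw1 : |u * (Real.sin (θ / 2) * Real.sin (φ / 2)) +
      v * (Real.cos (θ / 2) * Real.cos (φ / 2))| ≤ 1)
    (hw2 : |u * (Real.sin (θ / 2) * Real.sin (φ / 2)) -
      v * (Real.cos (θ / 2) * Real.cos (φ / 2))| ≤ 1) :
    HasSum (fun n => cConst α β * Real.sinh (t / 2) *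
      (2 * Real.exp (-(t / 2))) ^ (α + β + 2) * Real.exp (-(t / 2)) ^ (2 * n) *
        evenPart (gegenEven (α + β + 2) n) (Real.sin (θ / 2) * Real.sin (φ / 2))
          (Real.cos (θ / 2) * Real.cos (φ / 2)) u v) (PsiE α β t θ φ u v) := by
  set a := Real.sin (θ / 2) * Real.sin (φ / 2)
  set b := Real.cos (θ / 2) * Real.cos (φ / 2)
  set s := α + β + 2
  have hp := Real.exp_pos (-(t / 2))
  have hp1 : |Real.exp (-(t / 2))| < 1 := by
    rw [abs_of_pos hp, Real.exp_lt_one_iff]; linarith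
  have g1 := hasSum_gegenEven s hw1 hp1
  have g2 := hasSum_gegenEven s hw2 hp1
  have neg : ∀ w : ℝ, 1 + 2 * w * Real.exp (-(t / 2)) + Real.exp (-(t / 2)) ^ 2
      = 1 - 2 * (-w) * Real.exp (-(t / 2)) + Real.exp (-(t / 2)) ^ 2 := fun w => by ring
  rw [neg, rpow_generating ht hw1, rpow_generating ht (by rwa [abs_neg])] at g1
  rw [neg, rpow_generating ht hw2, rpow_generating ht (by rwa [abs_neg])] at g2
  have g := ((g1.add g2).div_const 2).mul_left
    (cConst α β * Real.sinh (t / 2) * (2 * Real.exp (-(t / 2))) ^ s)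
  have hD : (2 * Real.exp (-(t / 2))) ^ s * (2 * Real.exp (-(t / 2))) ^ (-s) = 1 := by
    rw [← Real.rpow_add (by positivity)]; simp
  refine hasSum_congr_of_eq g (fun n => ?_) ?_
  · rw [evenPart]
    ring
  · simp only [PsiE, Psi_eq]
    rw [show u * a + -v * b = u * a - v * b by ring,
      show -u * a + v * b = -(u * a - v * b) by ring,
      show -u * a + -v * b = -(u * a + v * b) by ring]
    linear_combination (-(1 / 4) * (cConst α β * Real.sinh (t / 2)) *
      (((Real.cosh (t / 2) - (u * a + v * b)) ^ s)⁻¹ +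
       ((Real.cosh (t / 2) - (u * a - v * b)) ^ s)⁻¹ +
       ((Real.cosh (t / 2) - -(u * a - v * b)) ^ s)⁻¹ +
       ((Real.cosh (t / 2) - -(u * a + v * b)) ^ s)⁻¹)) * hD

theorem half_angle_weights {θ φ : ℝ} (hθ : θ ∈ Set.Icc 0 Real.pi) (hφ : φ ∈ Set.Icc 0 Real.pi) :
    0 ≤ Real.sin (θ / 2) * Real.sin (φ / 2) ∧ 0 ≤ Real.cos (θ / 2) * Real.cos (φ / 2) ∧
    Real.sin (θ / 2) * Real.sin (φ / 2) + Real.cos (θ / 2) * Real.cos (φ / 2) ≤ 1 := by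
  have hs : ∀ x ∈ Set.Icc 0 Real.pi, 0 ≤ Real.sin (x / 2) ∧ 0 ≤ Real.cos (x / 2) := fun x hx =>
    ⟨Real.sin_nonneg_of_nonneg_of_le_pi (by linarith [hx.1]) (by linarith [hx.2, Real.pi_pos]),
      Real.cos_nonneg_of_mem_Icc ⟨by linarith [hx.1, Real.pi_pos], by linarith [hx.2]⟩⟩
  refine ⟨mul_nonneg (hs θ hθ).1 (hs φ hφ).1, mul_nonneg (hs θ hθ).2 (hs φ hφ).2, ?_⟩
  have := Real.cos_le_one (θ / 2 - φ / 2)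
  rw [Real.cos_sub] at this
  linarith

theorem cConst_pos {α β : ℝ} (hα : -1 < α) (hβ : -1 < β) : 0 < cConst α β := by
  have h1 := Real.Gamma_pos_of_pos (show 0 < α + β + 2 by linarith)
  have h2 := Real.Gamma_pos_of_pos (show 0 < α + 1 by linarith)
  have h3 := Real.Gamma_pos_of_pos (show 0 < β + 1 by linarith)
  rw [cConst]
  positivity

theorem regIntegral_PsiE {α β t θ φ : ℝ} (hα : -1 < α) (hβ : -1 < β) (ht : 0 < t)
    (hθ : θ ∈ Set.Icc 0 Real.pi) (hφ : φ ∈ Set.Icc 0 Real.pi) :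
    RegIntegrable α β (PsiE α β t θ φ) ∧
    HasSum (fun n => cConst α β * Real.sinh (t / 2) *
      (2 * Real.exp (-(t / 2))) ^ (α + β + 2) * Real.exp (-(t / 2)) ^ (2 * n) *
        gegenReg α β (Real.sin (θ / 2) * Real.sin (φ / 2))
          (Real.cos (θ / 2) * Real.cos (φ / 2)) n) (regIntegral α β (PsiE α β t θ φ)) := by
  obtain ⟨ha, hb, hab⟩ := half_angle_weights hθ hφ
  have hs : 0 < α + β + 2 := by linarith
  have hp := Real.exp_pos (-(t / 2))
  have hp1 : Real.exp (-(t / 2)) < 1 := by rw [Real.exp_lt_one_iff]; linarith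
  have hD : 0 ≤ cConst α β * Real.sinh (t / 2) * (2 * Real.exp (-(t / 2))) ^ (α + β + 2) := by
    have h1 := (cConst_pos hα hβ).le
    have h2 := Real.sinh_nonneg_iff.2 (show 0 ≤ t / 2 by positivity)
    positivity
  have h := regIntegrable_and_hasSum hα hβ (G := PsiE α β t θ φ)
    (F := fun n u v => cConst α β * Real.sinh (t / 2) *
      (2 * Real.exp (-(t / 2))) ^ (α + β + 2) * Real.exp (-(t / 2)) ^ (2 * n) *
        evenPart (gegenEven (α + β + 2) n) (Real.sin (θ / 2) * Real.sin (φ / 2))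
          (Real.cos (θ / 2) * Real.cos (φ / 2)) u v)
    (M := fun n => cConst α β * Real.sinh (t / 2) *
      (2 * Real.exp (-(t / 2))) ^ (α + β + 2) * Real.exp (-(t / 2)) ^ (2 * n) *
        gegenBound (α + β + 2) n)
    (fun n => by
      have := continuous_gegenEven (α + β + 2) n
      unfold evenPart
      fun_prop)
    (fun n => DiffBound.const_mul
      (fun u hu v hv => evenPart_gegenEven_bounds hs n ha hb hab hu hv) (by positivity))
    (by
      refine ((summable_gegenBound (α + β + 2) hp.le hp1).mul_left (cConst α β *
        Real.sinh (t / 2) * (2 * Real.exp (-(t / 2))) ^ (α + β + 2))).congr fun n => ?_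
      rw [mul_assoc _ (_ ^ (2 * n)), mul_comm (_ ^ (2 * n))])
    (fun u hu v hv => by
      obtain ⟨m1, m2⟩ := mem_Icc_of_weights ha hb hab hu hv
      exact hasSum_PsiE ht (abs_le.2 m1) (abs_le.2 m2))
  simp only [regIntegral_const_mul, regIntegral_gegenEven hα hβ] at h
  exact h

theorem auxKernelTerm_eq {α β : ℝ} (hα : -1 < α) (hβ : -1 < β) (t θ φ : ℝ) (n : ℕ) :
    auxKernelTerm α β t θ φ n = Real.exp (-(t / 2)) ^ (α + β + 1) *
      (Real.Gamma (α + β + 2) / (Real.Gamma (α + 1) * Real.Gamma (β + 1))) *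
      ((Real.exp (-(t / 2)) ^ 2) ^ n * (jacobiWeight α β n *
        appellF n (α + β + 1) (α + 1) (β + 1) ((Real.sin (θ / 2) * Real.sin (φ / 2)) ^ 2)
          ((Real.cos (θ / 2) * Real.cos (φ / 2)) ^ 2))) := by
  have h : Real.exp (-t * ((n : ℝ) + (α + β + 1) / 2))
      = Real.exp (-(t / 2)) ^ (α + β + 1) * (Real.exp (-(t / 2)) ^ 2) ^ n := by
    rw [← pow_mul, ← Real.rpow_natCast, ← Real.rpow_add (Real.exp_pos _), ← Real.exp_mul]
    congr 1
    push_cast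
    ring
  rw [auxKernelTerm, mul_assoc, trigJacobi_mul hα hβ, h, jacobiWeight]
  ring

theorem hasSum_auxKernelTerm {α β t θ φ : ℝ} (hα : -1 < α) (hβ : -1 < β) (ht : 0 < t)
    (hθ : θ ∈ Set.Icc 0 Real.pi) (hφ : φ ∈ Set.Icc 0 Real.pi) :
    HasSum (auxKernelTerm α β t θ φ) (regIntegral α β (PsiE α β t θ φ)) := by
  have h := (regIntegral_PsiE hα hβ ht hθ hφ).2
  set R := regIntegral α β (PsiE α β t θ φ)
  set p := Real.exp (-(t / 2)) with hpdef
  set D := cConst α β * Real.sinh (t / 2) * (2 * p) ^ (α + β + 2) with hDdef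
  have hp : 0 < p := Real.exp_pos _
  have hsh : 0 < Real.sinh (t / 2) := Real.sinh_pos_iff.2 (by positivity)
  have hD : D ≠ 0 := by
    have := cConst_pos hα hβ
    positivity
  have h2 := (h.mul_left D⁻¹)
  have h3 : HasSum (fun n => (p ^ 2) ^ n * gegenReg α β (Real.sin (θ / 2) * Real.sin (φ / 2))
      (Real.cos (θ / 2) * Real.cos (φ / 2)) n) (D⁻¹ * R) := by
    refine hasSum_congr_of_eq h2 (fun n => ?_) rfl
    rw [← pow_mul]
    field_simp
  have h4 := (hasSum_jacobiWeight_mul_appellF hα hβ h3).mul_left (p ^ (α + β + 1) *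
      (Real.Gamma (α + β + 2) / (Real.Gamma (α + 1) * Real.Gamma (β + 1))))
  have e : auxKernelTerm α β t θ φ = _ := funext fun n => auxKernelTerm_eq hα hβ t θ φ n
  rw [e]
  refine hasSum_congr_of_eq h4 (fun n => rfl) ?_
  have h5 : 1 - p ^ 2 = 2 * p * Real.sinh (t / 2) := by
    have : Real.exp (t / 2) * p = 1 := by rw [hpdef, ← Real.exp_add]; simp
    rw [Real.sinh_eq, ← hpdef]
    linear_combination -this
  -- The power of 2 in `cConst` cancels against (2p)^{α+β+2}, with one factor 2p left to combine
  -- with sinh(t/2) into 1 - p².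
  have h6 : D = p ^ (α + β + 1) *
      (Real.Gamma (α + β + 2) / (Real.Gamma (α + 1) * Real.Gamma (β + 1))) * (1 - p ^ 2) := by
    have g2 := (Real.Gamma_pos_of_pos (show 0 < α + 1 by linarith)).ne'
    have g3 := (Real.Gamma_pos_of_pos (show 0 < β + 1 by linarith)).ne'
    have g4 : (2 : ℝ) ^ (α + β + 1) ≠ 0 := by positivity
    rw [hDdef, h5, cConst, show α + β + 2 = α + β + 1 + 1 by ring,
      Real.rpow_add_one (show 2 * p ≠ 0 by positivity), Real.mul_rpow two_pos.le hp.le]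
    field_simp
  rw [← mul_assoc, ← h6]
  field_simp

end Kernel

end JacobiPoisson

end

theorem mainTheorem1 (α β t θ φ : ℝ) (hα : -1 < α) (hβ : -1 < β) (ht : 0 < t)
    (hθ : θ ∈ Set.Icc 0 Real.pi) (hφ : φ ∈ Set.Icc 0 Real.pi) :
    Summable (JacobiPoisson.auxKernelTerm α β t θ φ) ∧
    JacobiPoisson.PiIntegrable₂ α β (fun u v =>
      JacobiPoisson.PsiE α β t θ φ u v - JacobiPoisson.PsiE α β t θ φ u 1
        - JacobiPoisson.PsiE α β t θ φ 1 v + JacobiPoisson.PsiE α β t θ φ 1 1) ∧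
    JacobiPoisson.PiIntegrable α (fun u =>
      JacobiPoisson.PsiE α β t θ φ u 1 - JacobiPoisson.PsiE α β t θ φ 1 1) ∧
    JacobiPoisson.PiIntegrable β (fun v =>
      JacobiPoisson.PsiE α β t θ φ 1 v - JacobiPoisson.PsiE α β t θ φ 1 1) ∧
    JacobiPoisson.auxKernel α β t θ φ =
      4 * JacobiPoisson.piIntegral₂ α β (fun u v =>
          JacobiPoisson.PsiE α β t θ φ u v - JacobiPoisson.PsiE α β t θ φ u 1
            - JacobiPoisson.PsiE α β t θ φ 1 v + JacobiPoisson.PsiE α β t θ φ 1 1)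
        + 2 * JacobiPoisson.piIntegral α (fun u =>
            JacobiPoisson.PsiE α β t θ φ u 1 - JacobiPoisson.PsiE α β t θ φ 1 1)
        + 2 * JacobiPoisson.piIntegral β (fun v =>
            JacobiPoisson.PsiE α β t θ φ 1 v - JacobiPoisson.PsiE α β t θ φ 1 1)
        + JacobiPoisson.PsiE α β t θ φ 1 1 := by
  obtain ⟨h2, hu, hv⟩ := (JacobiPoisson.regIntegral_PsiE hα hβ ht hθ hφ).1
  have h := JacobiPoisson.hasSum_auxKernelTerm hα hβ ht hθ hφ
  -- The stated integrands and right-hand side are `secondDiff` and `regIntegral` unfolded, so the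
  -- components match definitionally.
  exact ⟨h.summable, h2, hu, hv, h.tsum_eq⟩
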